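/- Let $n\in\mathbb N$, let $\Omega_1,\Omega_2\subset\mathbb R^n$ be open, let $f$ be a homeomorphism of $\Omega_1$ onto $\Omega_2$ with $f\in BV_{\mathrm{loc}}(\Omega_1,\mathbb R^n)$ (every point of $\Omega_1$ lies in a ball $B\subset\Omega_1$ with $f\in BV(B,\mathbb R^n)$), and let $1\le q<\infty$, $q'=\frac{q}{q-1}$ ($q'=\infty$ if $q=1$). Let $D^af:\Omega_1\to\mathbb R^{n\times n}$ denote the density with respect to Lebesgue measure of the absolutely continuous part of the matrix-valued measure $Df$ (the distributional derivative of $f$), let $|D^af|$ be its Euclidean norm, and let $J_f=\det D^af$. Then the following are equivalent. (i) There is a nonnegative function $K^a\in L^{q'}(\Omega_2)$ such that $$\int_{f^{-1}(A)}|D^af(x)|\,dx\le\int_A K^a(y)\,dy\qquad\text{for all Borel sets }A\subset\Omega_2.$$ (ii) There is a function $L\in L^{q'}(\Omega_1)$ such that $$|D^af(x)|\le L(x)\,|J_f(x)|^{1/q}\qquad\text{for a.e. }x\in\Omega_1.$$ -/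

import Mathlib

open MeasureTheory Filter Topology
open scoped ENNReal ContDiff

/-- The integral `∫ φ dν` of a real function against a (finite) signed measure. -/
noncomputable def signedIntegral {α : Type*} [MeasurableSpace α]
    (ν : SignedMeasure α) (φ : α → ℝ) : ℝ :=
  (∫ x, φ x ∂ν.toJordanDecomposition.posPart) - ∫ x, φ x ∂ν.toJordanDecomposition.negPart

/-- On the open set `U`, the `i`-th distributional partial derivative of `u` is the signed
measure `ν`: `∫_U u ∂ᵢφ = -∫ φ dν` for every `φ ∈ C_c^∞(U)`. Only the restriction of `ν` to `U`
matters, and it is determined by `u`. -/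
def HasDistribPartialDeriv {n : ℕ} (U : Set (EuclideanSpace ℝ (Fin n)))
    (u : EuclideanSpace ℝ (Fin n) → ℝ) (i : Fin n)
    (ν : SignedMeasure (EuclideanSpace ℝ (Fin n))) : Prop :=
  ∀ φ : EuclideanSpace ℝ (Fin n) → ℝ, ContDiff ℝ ∞ φ → HasCompactSupport φ → tsupport φ ⊆ U →
    ∫ x in U, u x * fderiv ℝ φ x (EuclideanSpace.single i 1) = -signedIntegral ν φ

/-- `u ∈ BV(U)`: `u ∈ L¹(U)` and all distributional partial derivatives of `u` on `U` are
signed measures of finite total variation. -/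
def IsBV {n : ℕ} (U : Set (EuclideanSpace ℝ (Fin n)))
    (u : EuclideanSpace ℝ (Fin n) → ℝ) : Prop :=
  IntegrableOn u U ∧ ∀ i, ∃ ν, HasDistribPartialDeriv U u i ν

/-- `f ∈ BV_loc(Ω, ℝⁿ)`: every point of `Ω` lies in a ball `B ⊆ Ω` such that every component
of `f` belongs to `BV(B)`. -/
def IsBVLoc {n : ℕ} (Ω : Set (EuclideanSpace ℝ (Fin n)))
    (f : EuclideanSpace ℝ (Fin n) → EuclideanSpace ℝ (Fin n)) : Prop :=
  ∀ x ∈ Ω, ∃ c r, x ∈ Metric.ball c r ∧ Metric.ball c r ⊆ Ω ∧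
    ∀ j, IsBV (Metric.ball c r) (fun z => f z j)

open Classical in
/-- The measure `D_i u` on `U` (a signed measure whose restriction to `U` is the `i`-th
distributional partial derivative of `u` on `U`), or `0` if there is none. -/
noncomputable def distribPartialDeriv {n : ℕ} (U : Set (EuclideanSpace ℝ (Fin n)))
    (u : EuclideanSpace ℝ (Fin n) → ℝ) (i : Fin n) :
    SignedMeasure (EuclideanSpace ℝ (Fin n)) :=
  if h : ∃ ν, HasDistribPartialDeriv U u i ν then h.choose else 0

/-- The density `Dᵃf` of the absolutely continuous part of the matrix-valued measure `Df` with
respect to Lebesgue measure, as the Radon-Nikodym (Besicovitch) derivative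
`(Dᵃf(x))_{ji} = lim_{r → 0+} (D_i f_j)(B(x,r)) / |B(x,r)|`, a limit which exists for almost every
`x` in an open set on which `f` is locally of bounded variation. -/
noncomputable def acDeriv {n : ℕ}
    (f : EuclideanSpace ℝ (Fin n) → EuclideanSpace ℝ (Fin n)) (x : EuclideanSpace ℝ (Fin n)) :
    Matrix (Fin n) (Fin n) ℝ :=
  Matrix.of fun j i => limUnder (𝓝[>] (0 : ℝ)) fun r =>
    distribPartialDeriv (Metric.ball x r) (fun z => f z j) i (Metric.ball x r) /
      volume.real (Metric.ball x r)

/-- The Jacobian `J_f = det Dᵃf`. -/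
noncomputable def acJacobian {n : ℕ}
    (f : EuclideanSpace ℝ (Fin n) → EuclideanSpace ℝ (Fin n)) (x : EuclideanSpace ℝ (Fin n)) : ℝ :=
  (acDeriv f x).det

/-- The Euclidean (Frobenius) norm of a matrix. -/
noncomputable def matrixNorm {n : ℕ} (M : Matrix (Fin n) (Fin n) ℝ) : ℝ :=
  √(∑ j, ∑ i, M j i ^ 2)

/-! The analytic core is an area formula: off a Lebesgue null subset of `Ω₁`, the homeomorphism `f`
transforms volume with Jacobian `|J_f|`. Injective maps satisfy it on a measurable set along which
they are differentiable, so it suffices to cover almost all of `Ω₁` by countably many such pieces,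
with derivative `Dᵃf`.

The pieces are the sets where the variation measure of `Df` has mass at most `m ρ ^ n` in every ball
of radius `ρ ≤ 1 / (m + 1)`. At almost every `x` the measure `Df` has density `Dᵃf(x)` up to `o(ρ ^
n)` in total variation. Subtract the linear map and call a component of the difference `v`. Then `v
x` and `v y` are both compared with the mean of `v` against a bump of radius comparable to `δ ‖y -
x‖` around `y`. The comparison with `v x` costs `C δ⁻ⁿ ε ‖y - x‖`, by the small gradient at `x`; the
comparison with `v y` costs `C δ M ‖y - x‖`, by the mass bound at `y`. Taking `δ` small, then `ε`,
gives `o(‖y - x‖)` along the piece (`hasFDerivWithinAt_of_hasDensityAt`).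

With the area formula, (i) says that `|Dᵃf| ≤ (K ∘ f) |J_f|` almost everywhere. The `L^{q'}` norm of
`K` on the image of the good set is the norm of `(K ∘ f) |J_f| ^ (1 - 1/q)` on `Ω₁`, because `(1 -
1/q) q' = 1` for `q > 1`. Hence `L = (K ∘ f) |J_f| ^ (1 - 1/q)` in one direction and `K ∘ f = |Dᵃf|
/ |J_f|` in the other. The exceptional null set may have an image of positive measure, but (i)
integrates `|Dᵃf|` against Lebesgue measure and does not see it. -/

/-! ### Point values and means of a function with controlled gradient -/

/-- At every scale `ρ ≤ R`, the distributional gradient of `v` has mass at most `ε ρ ^ n` in the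
ball of radius `ρ` around `x`, as seen by test functions. -/
def GradientBound {n : ℕ} (v : EuclideanSpace ℝ (Fin n) → ℝ) (x : EuclideanSpace ℝ (Fin n))
    (R ε : ℝ) : Prop :=
  ∀ ρ, 0 < ρ → ρ ≤ R → ∀ (i : Fin n) (φ : EuclideanSpace ℝ (Fin n) → ℝ) (c : ℝ),
    ContDiff ℝ ∞ φ → tsupport φ ⊆ Metric.ball x ρ → (∀ z, |φ z| ≤ c) →
      |∫ z, v z * fderiv ℝ φ z (EuclideanSpace.single i 1)| ≤ c * ε * ρ ^ n

theorem GradientBound.mono {n : ℕ} {v : EuclideanSpace ℝ (Fin n) → ℝ}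
    {x : EuclideanSpace ℝ (Fin n)} {R R' ε : ℝ} (h : GradientBound v x R ε) (hR : R' ≤ R) :
    GradientBound v x R' ε :=
  fun ρ hρ hρR => h ρ hρ (hρR.trans hR)

section Dilation

variable {n : ℕ} {η : EuclideanSpace ℝ (Fin n) → ℝ} {x : EuclideanSpace ℝ (Fin n)}

theorem tsupport_dilate_subset {R s : ℝ} (hs : 0 < s) (hη : tsupport η ⊆ Metric.ball 0 R)
    (g : EuclideanSpace ℝ (Fin n) → ℝ) :
    tsupport (fun z => g z * η (s • (z - x))) ⊆ Metric.ball x (R / s) := by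
  have hcont : Continuous fun z : EuclideanSpace ℝ (Fin n) => s • (z - x) := by fun_prop
  have h1 : tsupport (fun z => g z * η (s • (z - x))) ⊆ (fun z => s • (z - x)) ⁻¹' tsupport η :=
    closure_minimal
      (fun z hz => subset_tsupport _ fun h => hz (by simp only [h, mul_zero]))
      ((isClosed_tsupport η).preimage hcont)
  intro z hz
  have h2 := hη (h1 hz)
  rw [mem_ball_zero_iff, norm_smul, Real.norm_of_nonneg hs.le] at h2
  rw [mem_ball_iff_norm, lt_div_iff₀ hs]
  linarith

theorem fderiv_coord_mul_dilate (hη : ContDiff ℝ ∞ η) (s : ℝ) (i : Fin n)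
    (z : EuclideanSpace ℝ (Fin n)) :
    fderiv ℝ (fun z => (s ^ n * s⁻¹ * (z i - x i)) * η (s • (z - x))) z
        (EuclideanSpace.single i 1) =
      s ^ n * s⁻¹ * η (s • (z - x)) +
        s ^ n * s⁻¹ * (z i - x i) * (s * fderiv ℝ η (s • (z - x)) (EuclideanSpace.single i 1)) := by
  have h1 : HasFDerivAt (fun z : EuclideanSpace ℝ (Fin n) => s ^ n * s⁻¹ * (z i - x i))
      ((s ^ n * s⁻¹) • EuclideanSpace.proj (𝕜 := ℝ) i) z :=
    ((EuclideanSpace.proj (𝕜 := ℝ) i).hasFDerivAt.sub_const (x i)).const_mul _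
  have h2 : HasFDerivAt (fun z : EuclideanSpace ℝ (Fin n) => s • (z - x))
      (s • ContinuousLinearMap.id ℝ _) z :=
    ((hasFDerivAt_id z).sub_const x).const_smul s
  have h3 : HasFDerivAt (fun z => η (s • (z - x))) _ z :=
    ((hη.differentiable (by simp)) (s • (z - x))).hasFDerivAt.comp z h2
  rw [HasFDerivAt.fderiv (f := fun z => (s ^ n * s⁻¹ * (z i - x i)) * η (s • (z - x))) (h1.mul h3)]
  simp
  ring

/-- The scale derivative of the dilated kernel `s ^ n η(s(z - x))` is a divergence. This turns the
change of a mean with the scale into a pairing with the distributional gradient. -/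
theorem sum_fderiv_coord_mul_dilate (hη : ContDiff ℝ ∞ η) {s : ℝ} (hs : 0 < s)
    (z : EuclideanSpace ℝ (Fin n)) :
    ∑ i, fderiv ℝ (fun z => (s ^ n * s⁻¹ * (z i - x i)) * η (s • (z - x))) z
        (EuclideanSpace.single i 1) =
      n * s ^ (n - 1) * η (s • (z - x)) + s ^ n * fderiv ℝ η (s • (z - x)) (z - x) := by
  have hb : ∑ i, (z i - x i) • EuclideanSpace.single i (1 : ℝ) = z - x := by
    ext j
    simp [Finset.sum_apply, Pi.single_apply]
  -- For `n = 0` the truncated exponent `n - 1` is harmless, because of the factor `n`.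
  have hpow : (n : ℝ) * s ^ (n - 1) = n * (s ^ n * s⁻¹) := by
    rcases n with _ | m
    · simp
    · simp only [Nat.add_sub_cancel]
      rw [pow_succ, mul_assoc (s ^ m), mul_inv_cancel₀ hs.ne', mul_one]
  simp_rw [fderiv_coord_mul_dilate hη]
  rw [Finset.sum_add_distrib]
  conv_rhs => rw [← hb, map_sum, Finset.mul_sum, hb, hpow]
  simp only [Finset.sum_const, Finset.card_univ, Fintype.card_fin, nsmul_eq_mul, map_smul,
    smul_eq_mul]
  congr 1
  · ring
  · refine Finset.sum_congr rfl fun i _ => ?_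
    field_simp

theorem hasDerivAt_dilate (hη : ContDiff ℝ ∞ η) (s : ℝ) (z : EuclideanSpace ℝ (Fin n)) :
    HasDerivAt (fun s : ℝ => s ^ n * η (s • (z - x)))
      (n * s ^ (n - 1) * η (s • (z - x)) + s ^ n * fderiv ℝ η (s • (z - x)) (z - x)) s := by
  have h2 : HasDerivAt (fun s : ℝ => s • (z - x)) ((1 : ℝ) • (z - x)) s :=
    (hasDerivAt_id s).smul_const _
  rw [one_smul] at h2
  exact (hasDerivAt_pow n s).mul
    (((hη.differentiable (by simp)) (s • (z - x))).hasFDerivAt.comp_hasDerivAt s h2)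

end Dilation

theorem hasCompactSupport_of_tsupport_subset_ball {n : ℕ} {φ : EuclideanSpace ℝ (Fin n) → ℝ}
    {x : EuclideanSpace ℝ (Fin n)} {ρ : ℝ} (h : tsupport φ ⊆ Metric.ball x ρ) :
    HasCompactSupport φ :=
  (isCompact_closedBall x ρ).of_isClosed_subset (isClosed_tsupport φ)
    (h.trans Metric.ball_subset_closedBall)

theorem integrable_mul_fderiv {n : ℕ} {v φ : EuclideanSpace ℝ (Fin n) → ℝ} (hv : Integrable v)
    (hφ : ContDiff ℝ ∞ φ) (hc : HasCompactSupport φ) (w : EuclideanSpace ℝ (Fin n)) :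
    Integrable fun z => v z * fderiv ℝ φ z w := by
  have hcont : Continuous fun z => fderiv ℝ φ z w :=
    (hφ.continuous_fderiv (by simp)).clm_apply continuous_const
  obtain ⟨C, hC⟩ := hcont.bounded_above_of_compact_support
    ((hc.fderiv (𝕜 := ℝ)).mono fun z hz h0 => hz (by simp [h0]))
  exact hv.mul_bdd hcont.aestronglyMeasurable (Eventually.of_forall hC)

section Mean

variable {n : ℕ} {v η : EuclideanSpace ℝ (Fin n) → ℝ} {x : EuclideanSpace ℝ (Fin n)} {R : ℝ}

theorem contDiff_coord_mul_dilate (hη : ContDiff ℝ ∞ η) (s : ℝ) (i : Fin n) :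
    ContDiff ℝ ∞ fun z : EuclideanSpace ℝ (Fin n) =>
      (s ^ n * s⁻¹ * (z i - x i)) * η (s • (z - x)) := by
  have h1 : ContDiff ℝ ∞ fun z : EuclideanSpace ℝ (Fin n) => z i :=
    (EuclideanSpace.proj (𝕜 := ℝ) i).contDiff
  exact (contDiff_const.mul (h1.sub contDiff_const)).mul
    (hη.comp ((contDiff_id.sub contDiff_const).const_smul s))

/-- The derivative in the scale of the mean of `v` against a dilated bump function. -/
theorem hasDerivAt_integral_dilate (hR : 0 < R) (hv : Integrable v) (hη : ContDiff ℝ ∞ η)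
    (hsupp : tsupport η ⊆ Metric.ball 0 R) {s : ℝ} (hs : 0 < s) :
    HasDerivAt (fun s : ℝ => ∫ z, v z * (s ^ n * η (s • (z - x))))
      (∑ i, ∫ z, v z * fderiv ℝ (fun z => (s ^ n * s⁻¹ * (z i - x i)) * η (s • (z - x))) z
        (EuclideanSpace.single i 1)) s := by
  have hcs := hasCompactSupport_of_tsupport_subset_ball hsupp
  obtain ⟨C₀, hC₀⟩ := hη.continuous.bounded_above_of_compact_support hcs
  obtain ⟨C₁, hC₁⟩ := (hη.continuous_fderiv (by simp)).bounded_above_of_compact_support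
    (hcs.fderiv (𝕜 := ℝ))
  have hC₀' : 0 ≤ C₀ := (norm_nonneg _).trans (hC₀ 0)
  have hC₁' : 0 ≤ C₁ := (norm_nonneg _).trans (hC₁ 0)
  have hcη : Continuous η := hη.continuous
  have hcη' : Continuous (fderiv ℝ η) := hη.continuous_fderiv (by simp)
  rw [← integral_finsetSum _ fun i _ => integrable_mul_fderiv hv (contDiff_coord_mul_dilate hη s i)
    (hasCompactSupport_of_tsupport_subset_ball (tsupport_dilate_subset hs hsupp _)) _]
  simp_rw [← Finset.mul_sum, sum_fderiv_coord_mul_dilate hη hs]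
  refine (hasDerivAt_integral_of_dominated_loc_of_deriv_le
    (F := fun (s : ℝ) z => v z * (s ^ n * η (s • (z - x))))
    (F' := fun (s : ℝ) z => v z *
      (n * s ^ (n - 1) * η (s • (z - x)) + s ^ n * fderiv ℝ η (s • (z - x)) (z - x)))
    (bound := fun z => ‖v z‖ *
      (n * (2 * s) ^ (n - 1) * C₀ + (2 * s) ^ n * (C₁ * (2 * R / s))))
    -- Scales stay above `s / 2`, so on the support of the dilated kernel `‖z - x‖ ≤ 2R / s`
    -- uniformly.
    (s := Set.Ioo (s / 2) (2 * s)) (Ioo_mem_nhds (by linarith) (by linarith)) ?_ ?_ ?_ ?_ ?_ ?_).2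
  · refine Eventually.of_forall fun t => hv.aestronglyMeasurable.mul ?_
    exact (Continuous.aestronglyMeasurable (by fun_prop))
  · refine hv.mul_bdd (c := s ^ n * C₀) (Continuous.aestronglyMeasurable (by fun_prop)) ?_
    refine Eventually.of_forall fun z => ?_
    rw [norm_mul, Real.norm_of_nonneg (by positivity)]
    gcongr
    exact hC₀ _
  · refine hv.aestronglyMeasurable.mul ?_
    refine Continuous.aestronglyMeasurable (Continuous.add (by fun_prop) ?_)
    exact continuous_const.mul ((hcη'.comp (by fun_prop)).clm_apply (by fun_prop))
  · refine Eventually.of_forall fun z t ht => ?_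
    have ht0 : 0 < t := by linarith [ht.1]
    rw [norm_mul]
    refine mul_le_mul_of_nonneg_left ?_ (norm_nonneg _)
    have hbound : ‖fderiv ℝ η (t • (z - x)) (z - x)‖ ≤ C₁ * (2 * R / s) := by
      by_cases hz : t • (z - x) ∈ tsupport η
      · have h2 := hsupp hz
        rw [mem_ball_zero_iff, norm_smul, Real.norm_of_nonneg ht0.le] at h2
        have h3 : ‖z - x‖ ≤ 2 * R / s := by
          rw [le_div_iff₀ hs]
          have := mul_le_mul_of_nonneg_right ht.1.le (norm_nonneg (z - x))
          linarith
        exact (ContinuousLinearMap.le_opNorm _ _).trans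
          (mul_le_mul (hC₁ _) h3 (norm_nonneg _) hC₁')
      · have h0 : fderiv ℝ η (t • (z - x)) = 0 := by
          by_contra h
          exact hz (support_fderiv_subset ℝ h)
        simpa [h0] using (by positivity : 0 ≤ C₁ * (2 * R / s))
    refine (norm_add_le _ _).trans (add_le_add ?_ ?_)
    · rw [norm_mul, Real.norm_of_nonneg (by positivity)]
      refine mul_le_mul ?_ (hC₀ _) (norm_nonneg _) (by positivity)
      gcongr
      exact ht.2.le
    · rw [norm_mul, Real.norm_of_nonneg (by positivity)]
      refine mul_le_mul ?_ hbound (norm_nonneg _) (by positivity)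
      gcongr
      exact ht.2.le
  · exact hv.norm.mul_const _
  · exact Eventually.of_forall fun z t _ => (hasDerivAt_dilate hη t z).const_mul (v z)

theorem integral_dilate (η : EuclideanSpace ℝ (Fin n) → ℝ) {s : ℝ} (hs : 0 < s) :
    ∫ z, s ^ n * η (s • (z - x)) = ∫ z, η z := by
  rw [integral_const_mul, integral_sub_right_eq_self (fun z => η (s • z)) x,
    Measure.integral_comp_smul, finrank_euclideanSpace_fin, abs_of_pos (by positivity),
    smul_eq_mul, ← mul_assoc, mul_inv_cancel₀ (by positivity), one_mul]

/-- The dilated kernels are an approximate identity; continuity at `x` replaces a Lebesgue point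
argument, so the limit is the actual value `v x`. -/
theorem tendsto_integral_dilate (hR : 0 < R) (hv : Integrable v) (hvx : ContinuousAt v x)
    (hη : Continuous η) (hsupp : tsupport η ⊆ Metric.ball 0 R) (hη0 : ∀ z, 0 ≤ η z)
    (hη1 : ∫ z, η z = 1) :
    Tendsto (fun t : ℝ => ∫ z, v z * ((t⁻¹) ^ n * η (t⁻¹ • (z - x)))) (𝓝[>] 0) (𝓝 (v x)) := by
  have hcs := hasCompactSupport_of_tsupport_subset_ball hsupp
  obtain ⟨C₀, hC₀⟩ := hη.bounded_above_of_compact_support hcs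
  rw [Metric.tendsto_nhds]
  intro e he
  obtain ⟨δ, hδ, hδv⟩ := Metric.continuousAt_iff.1 hvx (e / 2) (half_pos he)
  filter_upwards [Ioo_mem_nhdsGT (div_pos hδ hR)] with t ht
  have ht0 : 0 < t := ht.1
  have hs : 0 < t⁻¹ := inv_pos.2 ht0
  have hsm := tsupport_dilate_subset (x := x) hs hsupp (fun _ => (t⁻¹) ^ n)
  have hci : Integrable fun z => (t⁻¹) ^ n * η (t⁻¹ • (z - x)) :=
    Continuous.integrable_of_hasCompactSupport (by fun_prop)
      (hasCompactSupport_of_tsupport_subset_ball hsm)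
  have hvi : Integrable fun z => v z * ((t⁻¹) ^ n * η (t⁻¹ • (z - x))) := by
    refine hv.mul_bdd (c := (t⁻¹) ^ n * C₀) hci.aestronglyMeasurable ?_
    refine Eventually.of_forall fun z => ?_
    rw [norm_mul, Real.norm_of_nonneg (by positivity)]
    gcongr
    exact hC₀ _
  have hone := (integral_dilate (x := x) η hs).trans hη1
  have hsub : (∫ z, v z * ((t⁻¹) ^ n * η (t⁻¹ • (z - x)))) - v x =
      ∫ z, (v z - v x) * ((t⁻¹) ^ n * η (t⁻¹ • (z - x))) := by
    simp_rw [sub_mul]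
    rw [integral_sub hvi (hci.const_mul _), integral_const_mul, hone, mul_one]
  rw [Real.dist_eq, hsub]
  refine (lt_of_le_of_lt ?_ (half_lt_self he))
  rw [← Real.norm_eq_abs]
  calc _ ≤ ∫ z, e / 2 * ((t⁻¹) ^ n * η (t⁻¹ • (z - x))) := by
        refine norm_integral_le_of_norm_le (hci.const_mul _) (Eventually.of_forall fun z => ?_)
        have hnn : 0 ≤ (t⁻¹) ^ n * η (t⁻¹ • (z - x)) := mul_nonneg (by positivity) (hη0 _)
        rw [norm_mul, Real.norm_of_nonneg hnn]
        by_cases hz : (t⁻¹) ^ n * η (t⁻¹ • (z - x)) = 0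
        · rw [hz, mul_zero, mul_zero]
        · refine mul_le_mul_of_nonneg_right ?_ hnn
          have hzb := hsm (subset_tsupport _ hz)
          refine (hδv (lt_trans hzb ?_)).le
          rw [div_inv_eq_mul, mul_comm, ← lt_div_iff₀ hR]
          exact ht.2
    _ = e / 2 := by rw [integral_const_mul, hone, mul_one]

/-- A function with small gradient around `x` at all scales differs little at `x` from its means
against bump functions. -/
theorem GradientBound.abs_sub_integral_le {S ε : ℝ} (hb : GradientBound v x R ε) (hR : 0 < R)
    (hv : Integrable v) (hvx : ContinuousAt v x) (hη : ContDiff ℝ ∞ η)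
    (hsupp : tsupport η ⊆ Metric.ball 0 R) (hη0 : ∀ z, 0 ≤ η z) (hηS : ∀ z, η z ≤ S)
    (hη1 : ∫ z, η z = 1) :
    |(∫ z, v z * η (z - x)) - v x| ≤ n * R ^ (n + 1) * S * ε := by
  have hS : 0 ≤ S := (hη0 0).trans (hηS 0)
  have hderiv : ∀ t : ℝ, 0 < t → HasDerivAt
      (fun t : ℝ => ∫ z, v z * ((t⁻¹) ^ n * η (t⁻¹ • (z - x)))) _ t := fun t ht =>
    HasDerivAt.comp t (hasDerivAt_integral_dilate (x := x) hR hv hη hsupp (inv_pos.2 ht))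
      (hasDerivAt_inv ht.ne')
  -- The factor `s ^ 2` comes from the chain rule for `s = t⁻¹`. It exactly cancels the decay in
  -- `s`, so the means are Lipschitz in `t` on `(0, 1]`. The condition `1 ≤ s` keeps the radius `R /
  -- s` within the allowed scales.
  have hbound : ∀ s : ℝ, 1 ≤ s → |∑ i, ∫ z, v z *
      fderiv ℝ (fun z => (s ^ n * s⁻¹ * (z i - x i)) * η (s • (z - x))) z
        (EuclideanSpace.single i 1)| * s ^ 2 ≤ n * R ^ (n + 1) * S * ε := by
    intro s hs1
    have hs : 0 < s := zero_lt_one.trans_le hs1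
    have hterm : ∀ i : Fin n, |∫ z, v z *
        fderiv ℝ (fun z => (s ^ n * s⁻¹ * (z i - x i)) * η (s • (z - x))) z
          (EuclideanSpace.single i 1)| ≤ (s ^ n * s⁻¹ * (R / s) * S) * ε * (R / s) ^ n := by
      intro i
      refine hb (R / s) (by positivity) (div_le_self hR.le hs1) i _ _
        (contDiff_coord_mul_dilate hη s i) (tsupport_dilate_subset hs hsupp _) fun z => ?_
      by_cases hz : η (s • (z - x)) = 0
      · simp only [hz, mul_zero, abs_zero]
        positivity
      · have h2 := hsupp (subset_tsupport _ hz)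
        rw [mem_ball_zero_iff, norm_smul, Real.norm_of_nonneg hs.le, mul_comm,
          ← lt_div_iff₀ hs] at h2
        have h3 : |z i - x i| ≤ R / s := by
          have := PiLp.norm_apply_le (p := 2) (z - x) i
          rw [PiLp.sub_apply, Real.norm_eq_abs] at this
          exact this.trans h2.le
        rw [abs_mul, abs_mul, abs_of_nonneg (hη0 _),
          abs_of_nonneg (by positivity : 0 ≤ s ^ n * s⁻¹)]
        exact mul_le_mul (mul_le_mul_of_nonneg_left h3 (by positivity)) (hηS _) (hη0 _)
          (by positivity)
    calc _ ≤ (∑ _i : Fin n, (s ^ n * s⁻¹ * (R / s) * S) * ε * (R / s) ^ n) * s ^ 2 := by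
          refine mul_le_mul_of_nonneg_right ?_ (by positivity)
          exact (Finset.abs_sum_le_sum_abs _ _).trans (Finset.sum_le_sum fun i _ => hterm i)
      _ = n * R ^ (n + 1) * S * ε := by
          rw [Finset.sum_const, Finset.card_univ, Fintype.card_fin, nsmul_eq_mul, div_pow]
          field_simp
          ring
  have hε : 0 ≤ n * R ^ (n + 1) * S * ε := (by positivity : (0 : ℝ) ≤ _).trans (hbound 1 le_rfl)
  have hstep : ∀ t ∈ Set.Ioo (0 : ℝ) 1, |(∫ z, v z * η (z - x)) -
      ∫ z, v z * ((t⁻¹) ^ n * η (t⁻¹ • (z - x)))| ≤ n * R ^ (n + 1) * S * ε := by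
    intro t ht
    have h := norm_image_sub_le_of_norm_deriv_le_segment'
      (fun τ (hτ : τ ∈ Set.Icc t 1) => (hderiv τ (ht.1.trans_le hτ.1)).hasDerivWithinAt)
      (C := n * R ^ (n + 1) * S * ε) (fun τ hτ => ?_) 1 ⟨ht.2.le, le_rfl⟩
    · simp only [inv_one, one_pow, one_mul, one_smul, Real.norm_eq_abs] at h
      refine h.trans (mul_le_of_le_one_right hε (by linarith [ht.1]))
    · have hτ0 : 0 < τ := ht.1.trans_le hτ.1
      have h1 := hbound τ⁻¹ ((one_le_inv₀ hτ0).2 hτ.2.le)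
      rw [norm_mul, norm_neg, Real.norm_eq_abs, Real.norm_of_nonneg (by positivity), ← inv_pow]
      exact h1
  have hlim := ((tendsto_integral_dilate hR hv hvx hη.continuous hsupp hη0 hη1).const_sub
    (∫ z, v z * η (z - x))).abs
  refine le_of_tendsto hlim ?_
  filter_upwards [Ioo_mem_nhdsGT (zero_lt_one (α := ℝ))] with t ht using hstep t ht

end Mean

/-- Comparison of two values of a function by means of a bump function concentrated near `y`. -/
theorem GradientBound.abs_sub_le {n : ℕ} {v : EuclideanSpace ℝ (Fin n) → ℝ}
    {x y : EuclideanSpace ℝ (Fin n)} {δ ε M : ℝ} (hv : Integrable v) (hvx : ContinuousAt v x)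
    (hvy : ContinuousAt v y) (hδ : 0 < δ) (hδ1 : δ ≤ 1) (hxy : x ≠ y)
    (hx : GradientBound v x (2 * ‖y - x‖) ε) (hy : GradientBound v y (δ * ‖y - x‖) M) :
    |v y - v x| ≤ n * 4 ^ n / volume.real (Metric.ball (0 : EuclideanSpace ℝ (Fin n)) 1) *
      (2 ^ (n + 1) * (δ ^ n)⁻¹ * ε + δ * M) * ‖y - x‖ := by
  set r := ‖y - x‖ with hr
  have hr0 : 0 < r := norm_pos_iff.2 (sub_ne_zero.2 hxy.symm)
  set κ := volume.real (Metric.ball (0 : EuclideanSpace ℝ (Fin n)) 1) with hκ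
  have hκ0 : 0 < κ := ENNReal.toReal_pos (Metric.measure_ball_pos _ _ one_pos).ne'
    measure_ball_lt_top.ne
  -- The height of the normalized bump is at most the inverse volume of its inner ball, `4 ^ n / (κ
  -- (δ r) ^ n)`. Seen from `y` the support has scale `δ r`; seen from `x` it lies within distance
  -- `3r / 2`.
  let b : ContDiffBump (0 : EuclideanSpace ℝ (Fin n)) :=
    ⟨δ * r / 4, δ * r / 2, by positivity, by linarith [mul_pos hδ hr0]⟩
  set η := b.normed volume with hηdef
  have hη : ContDiff ℝ ∞ η := b.contDiff_normed
  have hη0 : ∀ z, 0 ≤ η z := fun z => b.nonneg_normed z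
  have hη1 : ∫ z, η z = 1 := b.integral_normed
  have hts : tsupport η = Metric.closedBall 0 (δ * r / 2) := b.tsupport_normed_eq
  have hηS : ∀ z, η z ≤ 4 ^ n / (κ * (δ * r) ^ n) := by
    intro z
    refine (b.normed_le_div_measure_closedBall_rIn volume z).trans (le_of_eq ?_)
    have : volume.real (Metric.closedBall (0 : EuclideanSpace ℝ (Fin n)) b.rIn) =
        (δ * r / 4) ^ n * κ := by
      rw [Measure.real, Measure.addHaar_closedBall _ _ b.rIn_pos.le, ENNReal.toReal_mul,
        finrank_euclideanSpace_fin, ENNReal.toReal_ofReal (by positivity)]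
      rfl
    rw [this, div_pow]
    field_simp
  have h1 := hy.abs_sub_integral_le (by positivity) hv hvy hη
    (by rw [hts]; exact Metric.closedBall_subset_ball (half_lt_self (by positivity))) hη0 hηS hη1
  have h2 := hx.abs_sub_integral_le (η := fun z => η (z - (y - x))) (by positivity) hv hvx
    (hη.comp (contDiff_id.sub contDiff_const)) (S := 4 ^ n / (κ * (δ * r) ^ n)) ?_
    (fun z => hη0 _) (fun z => hηS _) ((integral_sub_right_eq_self η (y - x)).trans hη1)
  · have h3 : ∀ z : EuclideanSpace ℝ (Fin n), z - x - (y - x) = z - y := fun z => by abel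
    simp_rw [h3] at h2
    have h4 : |v y - v x| ≤ |(∫ z, v z * η (z - y)) - v x| + |(∫ z, v z * η (z - y)) - v y| := by
      have := abs_sub ((∫ z, v z * η (z - y)) - v x) ((∫ z, v z * η (z - y)) - v y)
      simpa using this
    refine h4.trans ((add_le_add h2 h1).trans (le_of_eq ?_))
    rw [mul_pow, mul_pow, mul_pow]
    field_simp
    ring
  · refine closure_minimal (fun z hz => ?_) Metric.isClosed_closedBall |>.trans
      (Metric.closedBall_subset_ball (ε₁ := 3 / 2 * r) (by linarith))
    have h5 : z - (y - x) ∈ Metric.closedBall 0 (δ * r / 2) := hts ▸ subset_tsupport η hz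
    rw [mem_closedBall_zero_iff] at h5 ⊢
    calc ‖z‖ = ‖(z - (y - x)) + (y - x)‖ := by rw [sub_add_cancel]
      _ ≤ δ * r / 2 + r := (norm_add_le _ _).trans (add_le_add_left h5 _)
      _ ≤ 3 / 2 * r := by nlinarith

/-! ### Densities of measures at almost every point -/

theorem volume_real_ball {n : ℕ} (x : EuclideanSpace ℝ (Fin n)) {r : ℝ} (hr : 0 < r) :
    volume.real (Metric.ball x r) =
      r ^ n * volume.real (Metric.ball (0 : EuclideanSpace ℝ (Fin n)) 1) := by
  rw [Measure.real, Measure.addHaar_ball_of_pos _ _ hr, ENNReal.toReal_mul,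
    finrank_euclideanSpace_fin, ENNReal.toReal_ofReal (by positivity)]
  rfl

theorem volume_closedBall_eq_volume_ball {n : ℕ} (x : EuclideanSpace ℝ (Fin n)) {r : ℝ}
    (hr : 0 < r) : volume (Metric.closedBall x r) = volume (Metric.ball x r) := by
  rw [Measure.addHaar_closedBall _ _ hr.le, Measure.addHaar_ball_of_pos _ _ hr]

/-- Near `x`, the measure `p` is `g` times Lebesgue measure, up to an error of total variation
`o(ρ ^ n)` on the ball of radius `ρ`. -/
def HasDensityAt {n : ℕ} (p : Measure (EuclideanSpace ℝ (Fin n))) (x : EuclideanSpace ℝ (Fin n))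
    (g : ℝ) : Prop :=
  ∀ ε, 0 < ε → ∃ R, 0 < R ∧ ∀ ρ, 0 < ρ → ρ ≤ R → ∀ (φ : EuclideanSpace ℝ (Fin n) → ℝ) (c : ℝ),
    Measurable φ → (∀ z, |φ z| ≤ c) → Function.support φ ⊆ Metric.ball x ρ →
      |(∫ z, φ z ∂p) - g * ∫ z, φ z| ≤ c * ε * ρ ^ n

theorem integrable_of_abs_le_of_support_subset {n : ℕ} {p : Measure (EuclideanSpace ℝ (Fin n))}
    [IsLocallyFiniteMeasure p] {φ : EuclideanSpace ℝ (Fin n) → ℝ} {c : ℝ} (hφ : Measurable φ)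
    (hc : ∀ z, |φ z| ≤ c) {x : EuclideanSpace ℝ (Fin n)} {ρ : ℝ}
    (hs : Function.support φ ⊆ Metric.ball x ρ) : Integrable φ p := by
  have h : IntegrableOn φ (Metric.ball x ρ) p :=
    Measure.integrableOn_of_bounded (M := c) measure_ball_lt_top.ne hφ.aestronglyMeasurable
      (Eventually.of_forall hc)
  rwa [← integrableOn_iff_integrable_of_support_subset hs]

theorem abs_integral_le_of_support_subset {n : ℕ} {p : Measure (EuclideanSpace ℝ (Fin n))}
    [IsLocallyFiniteMeasure p] {φ : EuclideanSpace ℝ (Fin n) → ℝ} {c : ℝ}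
    (hc : ∀ z, |φ z| ≤ c) {x : EuclideanSpace ℝ (Fin n)} {ρ : ℝ}
    (hs : Function.support φ ⊆ Metric.ball x ρ) :
    |∫ z, φ z ∂p| ≤ c * p.real (Metric.ball x ρ) := by
  rw [← setIntegral_eq_integral_of_forall_compl_eq_zero (s := Metric.ball x ρ)
    (fun z hz => by_contra fun h => hz (hs h)), ← Real.norm_eq_abs]
  exact norm_setIntegral_le_of_norm_le_const measure_ball_lt_top fun z _ => hc z

/-- At almost every `x` the singular part has zero density, and `x` is a Lebesgue point of the
Radon-Nikodym derivative; each contributes half of the error. -/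
theorem ae_hasDensityAt {n : ℕ} (p : Measure (EuclideanSpace ℝ (Fin n))) [IsFiniteMeasure p] :
    ∀ᵐ x, HasDensityAt p x (p.rnDeriv volume x).toReal := by
  set k : EuclideanSpace ℝ (Fin n) → ℝ := fun x => (p.rnDeriv volume x).toReal with hk
  have hki : Integrable k := Measure.integrable_toReal_rnDeriv
  set κ := volume.real (Metric.ball (0 : EuclideanSpace ℝ (Fin n)) 1) with hκ
  have hκ0 : 0 < κ := ENNReal.toReal_pos (Metric.measure_ball_pos _ _ one_pos).ne'
    measure_ball_lt_top.ne
  filter_upwards [(Besicovitch.vitaliFamily volume).ae_eventually_measure_zero_of_singular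
      (Measure.mutuallySingular_singularPart p volume),
    (Besicovitch.vitaliFamily volume).ae_tendsto_lintegral_enorm_sub_div hki.locallyIntegrable]
    with x hx1 hx2 ε hε
  have h1 := hx1.comp (Besicovitch.tendsto_filterAt volume x)
  have h2 := hx2.comp (Besicovitch.tendsto_filterAt volume x)
  have hε' : (0 : ℝ≥0∞) < ENNReal.ofReal (ε / (2 * κ)) := ENNReal.ofReal_pos.2 (by positivity)
  obtain ⟨R, hR, hRs⟩ := mem_nhdsGT_iff_exists_Ioc_subset.1
    ((h1.eventually_lt_const hε').and (h2.eventually_lt_const hε'))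
  refine ⟨R, hR, fun ρ hρ hρR φ c hφ hc hs => ?_⟩
  obtain ⟨h3, h4⟩ := hRs ⟨hρ, hρR⟩
  simp only [Function.comp_apply] at h3 h4
  have hball : volume (Metric.closedBall x ρ) = ENNReal.ofReal (ρ ^ n * κ) := by
    rw [volume_closedBall_eq_volume_ball x hρ, ← volume_real_ball x hρ,
      ofReal_measureReal measure_ball_lt_top.ne]
  have hpos : 0 < ρ ^ n * κ := by positivity
  have hc0 : 0 ≤ c := (abs_nonneg _).trans (hc x)
  have hscale : ∀ a : ℝ≥0∞, a / volume (Metric.closedBall x ρ) < ENNReal.ofReal (ε / (2 * κ)) →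
      a ≤ ENNReal.ofReal (ε / 2 * ρ ^ n) := by
    intro a ha
    rw [hball] at ha
    have := (ENNReal.div_lt_iff (Or.inl (ENNReal.ofReal_pos.2 hpos).ne')
      (Or.inl ENNReal.ofReal_ne_top)).1 ha
    rw [← ENNReal.ofReal_mul (by positivity)] at this
    refine this.le.trans (le_of_eq ?_)
    congr 1
    field_simp
  have h3' := hscale _ h3
  have h4' := hscale _ h4
  have hsing : |∫ z, φ z ∂p.singularPart volume| ≤ c * (ε / 2 * ρ ^ n) := by
    refine (abs_integral_le_of_support_subset hc hs).trans (mul_le_mul_of_nonneg_left ?_ hc0)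
    exact ENNReal.toReal_le_of_le_ofReal (by positivity)
      ((measure_mono Metric.ball_subset_closedBall).trans h3')
  have hac : |(∫ z, k z * φ z) - k x * ∫ z, φ z| ≤ c * (ε / 2 * ρ ^ n) := by
    have hφi : Integrable φ := integrable_of_abs_le_of_support_subset hφ hc hs
    have hkφ : Integrable fun z => k z * φ z :=
      hki.mul_bdd hφ.aestronglyMeasurable (Eventually.of_forall hc)
    rw [← integral_const_mul, ← integral_sub hkφ (hφi.const_mul _),
      ← setIntegral_eq_integral_of_forall_compl_eq_zero (s := Metric.closedBall x ρ)
        (fun z hz => by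
          have : φ z = 0 := by_contra fun h => hz (Metric.ball_subset_closedBall (hs h))
          simp [this])]
    have hint : IntegrableOn (fun z => k z - k x) (Metric.closedBall x ρ) :=
      hki.integrableOn.sub (integrableOn_const measure_closedBall_lt_top.ne)
    calc ‖∫ z in Metric.closedBall x ρ, (k z * φ z - k x * φ z)‖
        ≤ ∫ z in Metric.closedBall x ρ, c * ‖k z - k x‖ := by
          refine norm_integral_le_of_norm_le (hint.norm.const_mul c)
            (Eventually.of_forall fun z => ?_)
          rw [← sub_mul, norm_mul, mul_comm]
          exact mul_le_mul_of_nonneg_right (hc z) (norm_nonneg _)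
      _ = c * ∫ z in Metric.closedBall x ρ, ‖k z - k x‖ := integral_const_mul _ _
      _ ≤ c * (ε / 2 * ρ ^ n) := by
          refine mul_le_mul_of_nonneg_left ?_ hc0
          rw [integral_norm_eq_lintegral_enorm hint.aestronglyMeasurable]
          exact ENNReal.toReal_le_of_le_ofReal (by positivity) h4'
  have hsplit : ∫ z, φ z ∂p = (∫ z, φ z ∂p.singularPart volume) + ∫ z, k z * φ z := by
    conv_lhs => rw [Measure.haveLebesgueDecomposition_add p volume]
    have hfin : IsFiniteMeasure (volume.withDensity (p.rnDeriv volume)) :=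
      isFiniteMeasure_withDensity (Measure.lintegral_rnDeriv_lt_top p volume).ne
    rw [integral_add_measure (integrable_of_abs_le_of_support_subset hφ hc hs)
      (integrable_of_abs_le_of_support_subset hφ hc hs),
      integral_withDensity_eq_integral_toReal_smul (Measure.measurable_rnDeriv _ _)
        (Measure.rnDeriv_lt_top p volume)]
    rfl
  rw [hsplit, add_sub_assoc]
  refine (abs_add_le _ _).trans ((add_le_add hsing hac).trans (le_of_eq ?_))
  ring

theorem HasDensityAt.tendsto {n : ℕ} {p : Measure (EuclideanSpace ℝ (Fin n))}
    {x : EuclideanSpace ℝ (Fin n)} {g : ℝ} (h : HasDensityAt p x g) :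
    Tendsto (fun r => p.real (Metric.ball x r) / volume.real (Metric.ball x r)) (𝓝[>] 0)
      (𝓝 g) := by
  set κ := volume.real (Metric.ball (0 : EuclideanSpace ℝ (Fin n)) 1) with hκ
  have hκ0 : 0 < κ := ENNReal.toReal_pos (Metric.measure_ball_pos _ _ one_pos).ne'
    measure_ball_lt_top.ne
  rw [Metric.tendsto_nhds]
  intro e he
  obtain ⟨R, hR, hRb⟩ := h (e / 2 * κ) (by positivity)
  filter_upwards [Ioc_mem_nhdsGT hR] with r hr
  have h1 := hRb r hr.1 hr.2 (Set.indicator (Metric.ball x r) 1) 1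
    (measurable_one.indicator measurableSet_ball)
    (fun z => by
      by_cases hz : z ∈ Metric.ball x r
      · simp [Set.indicator_of_mem hz]
      · simp [Set.indicator_of_notMem hz])
    Set.support_indicator_subset
  rw [integral_indicator_one measurableSet_ball, integral_indicator_one measurableSet_ball] at h1
  have hv := volume_real_ball x hr.1
  have hpos : 0 < volume.real (Metric.ball x r) := by
    rw [hv]
    have := hr.1
    positivity
  rw [Real.dist_eq, div_sub' hpos.ne', abs_div, abs_of_pos hpos, div_lt_iff₀ hpos,
    mul_comm (volume.real _) g]
  refine h1.trans_lt ?_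
  rw [hv]
  have : 0 < κ * r ^ n := mul_pos hκ0 (pow_pos hr.1 n)
  nlinarith

/-- The points around which the mass of `σ` in small balls is controlled by `m` times the volume
scale. -/
def densityBoundedSet {n : ℕ} (σ : Measure (EuclideanSpace ℝ (Fin n))) (m : ℕ) :
    Set (EuclideanSpace ℝ (Fin n)) :=
  {x | ∀ ρ : ℝ, 0 < ρ → ρ * (m + 1) ≤ 1 → σ (Metric.ball x ρ) ≤ ENNReal.ofReal (m * ρ ^ n)}

/-- An open ball with too much mass has a slightly smaller concentric ball with too much mass, and
this one lies in the ball of the original radius around any nearby centre. -/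
theorem isClosed_densityBoundedSet {n : ℕ} (σ : Measure (EuclideanSpace ℝ (Fin n))) (m : ℕ) :
    IsClosed (densityBoundedSet σ m) := by
  rw [← isOpen_compl_iff, Metric.isOpen_iff]
  intro x hx
  simp only [densityBoundedSet, Set.mem_compl_iff, Set.mem_ofPred_eq, not_forall, not_le] at hx
  obtain ⟨ρ, hρ, hρm, hlt⟩ := hx
  have hU : Metric.ball x ρ = ⋃ k : ℕ, Metric.ball x (ρ - 1 / ((k : ℝ) + 1)) := by
    ext z
    simp only [Set.mem_iUnion, Metric.mem_ball]
    constructor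
    · intro hz
      obtain ⟨k, hk⟩ := exists_nat_one_div_lt (sub_pos.2 hz)
      exact ⟨k, by linarith⟩
    · rintro ⟨k, hk⟩
      have : (0 : ℝ) < 1 / ((k : ℝ) + 1) := by positivity
      linarith
  have hmono : Monotone fun k : ℕ => Metric.ball x (ρ - 1 / ((k : ℝ) + 1)) := by
    intro a b hab
    refine Metric.ball_subset_ball (sub_le_sub_left ?_ _)
    exact Nat.one_div_le_one_div hab
  rw [hU, hmono.measure_iUnion, lt_iSup_iff] at hlt
  obtain ⟨k, hk⟩ := hlt
  refine ⟨1 / ((k : ℝ) + 1), by positivity, fun y hy hyS => ?_⟩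
  refine absurd (hyS ρ hρ hρm) (not_le.2 (hk.trans_le (measure_mono ?_)))
  refine Metric.ball_subset_ball' ?_
  rw [dist_comm]
  linarith [Metric.mem_ball.1 hy]

theorem HasDensityAt.exists_mem_densityBoundedSet {n : ℕ}
    {σ : Measure (EuclideanSpace ℝ (Fin n))} [IsFiniteMeasure σ] {x : EuclideanSpace ℝ (Fin n)}
    {g : ℝ} (h : HasDensityAt σ x g) : ∃ m, x ∈ densityBoundedSet σ m := by
  set κ := volume.real (Metric.ball (0 : EuclideanSpace ℝ (Fin n)) 1) with hκ
  have hκ0 : 0 < κ := ENNReal.toReal_pos (Metric.measure_ball_pos _ _ one_pos).ne'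
    measure_ball_lt_top.ne
  obtain ⟨R, hR, hRs⟩ := mem_nhdsGT_iff_exists_Ioc_subset.1
    (h.tendsto.eventually_lt_const (lt_add_one g))
  obtain ⟨m₁, hm₁⟩ := exists_nat_gt ((g + 1) * κ)
  obtain ⟨m₂, hm₂⟩ := exists_nat_gt R⁻¹
  refine ⟨max m₁ m₂, fun ρ hρ hρm => ?_⟩
  have hρR : ρ ≤ R := by
    have h1 : R⁻¹ ≤ (max m₁ m₂ : ℕ) + 1 := by
      have : (m₂ : ℝ) ≤ (max m₁ m₂ : ℕ) := by exact_mod_cast le_max_right m₁ m₂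
      linarith
    have h2 : ρ * R⁻¹ ≤ 1 := (mul_le_mul_of_nonneg_left h1 hρ.le).trans hρm
    rwa [← div_eq_mul_inv, div_le_one hR] at h2
  have h3 := hRs ⟨hρ, hρR⟩
  have hpos : 0 < ρ ^ n * κ := by positivity
  simp only [Set.mem_ofPred_eq] at h3
  rw [volume_real_ball x hρ, ← hκ, div_lt_iff₀ hpos] at h3
  rw [← ofReal_measureReal (measure_ne_top σ _)]
  refine ENNReal.ofReal_le_ofReal (h3.le.trans ?_)
  have h4 : (m₁ : ℝ) ≤ (max m₁ m₂ : ℕ) := by exact_mod_cast le_max_left m₁ m₂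
  have := pow_pos hρ n
  nlinarith

/-! ### Distributional derivatives and the limit defining `acDeriv` -/

theorem signedMeasure_apply_eq_real_sub {α : Type*} [MeasurableSpace α] (ν : SignedMeasure α)
    {A : Set α} (hA : MeasurableSet A) :
    ν A = ν.toJordanDecomposition.posPart.real A - ν.toJordanDecomposition.negPart.real A := by
  conv_lhs => rw [← ν.toSignedMeasure_toJordanDecomposition]
  rw [JordanDecomposition.toSignedMeasure, sub_apply,
    Measure.toSignedMeasure_apply_measurable hA, Measure.toSignedMeasure_apply_measurable hA]

theorem HasDistribPartialDeriv.mono {n : ℕ} {U V : Set (EuclideanSpace ℝ (Fin n))}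
    {u : EuclideanSpace ℝ (Fin n) → ℝ} {i : Fin n} {ν : SignedMeasure (EuclideanSpace ℝ (Fin n))}
    (h : HasDistribPartialDeriv U u i ν) (hVU : V ⊆ U) : HasDistribPartialDeriv V u i ν := by
  intro φ hφ hc hs
  rw [← h φ hφ hc (hs.trans hVU)]
  have hzero : ∀ z ∉ V, u z * fderiv ℝ φ z (EuclideanSpace.single i 1) = 0 := fun z hz => by
    rw [fderiv_of_notMem_tsupport ℝ fun hz' => hz (hs hz')]
    simp
  rw [setIntegral_eq_integral_of_forall_compl_eq_zero hzero,
    setIntegral_eq_integral_of_forall_compl_eq_zero fun z hz => hzero z fun hz' => hz (hVU hz')]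

theorem exists_seq_contDiff_tendsto_indicator_ball {n : ℕ} (x : EuclideanSpace ℝ (Fin n)) {r : ℝ}
    (hr : 0 < r) : ∃ φ : ℕ → EuclideanSpace ℝ (Fin n) → ℝ,
      (∀ k, ContDiff ℝ ∞ (φ k) ∧ tsupport (φ k) ⊆ Metric.ball x r ∧ ∀ z, |φ k z| ≤ 1) ∧
      ∀ z, Tendsto (fun k => φ k z) atTop (𝓝 (Set.indicator (Metric.ball x r) 1 z)) := by
  have hk : ∀ k : ℕ, 0 < 1 / ((k : ℝ) + 2) ∧ 1 / ((k : ℝ) + 2) ≤ 1 / 2 := fun k =>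
    ⟨by positivity, one_div_le_one_div_of_le two_pos (by linarith [(k.cast_nonneg : (0 : ℝ) ≤ k)])⟩
  let b : ℕ → ContDiffBump x := fun k =>
    ⟨r * (1 - 1 / ((k : ℝ) + 2)), r * (1 - 1 / ((k : ℝ) + 2) / 2),
      mul_pos hr (by linarith [hk k]), mul_lt_mul_of_pos_left (by linarith [hk k]) hr⟩
  refine ⟨fun k => b k, fun k => ⟨(b k).contDiff, ?_, fun z => ?_⟩, fun z => ?_⟩
  · rw [(b k).tsupport_eq]
    refine Metric.closedBall_subset_ball ?_
    change r * (1 - 1 / ((k : ℝ) + 2) / 2) < r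
    nlinarith [hk k, mul_pos hr (hk k).1]
  · rw [abs_of_nonneg (b k).nonneg]
    exact (b k).le_one
  · by_cases hz : z ∈ Metric.ball x r
    · rw [Set.indicator_of_mem hz]
      have hz' : 0 < 1 - dist z x / r := by
        rw [sub_pos, div_lt_one hr]
        exact hz
      obtain ⟨N, hN⟩ := exists_nat_one_div_lt hz'
      refine tendsto_const_nhds.congr' ?_
      filter_upwards [eventually_ge_atTop N] with k hkN
      refine ((b k).one_of_mem_closedBall ?_).symm
      rw [Metric.mem_closedBall]
      change dist z x ≤ r * (1 - 1 / ((k : ℝ) + 2))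
      have h1 : 1 / ((k : ℝ) + 2) ≤ 1 / ((N : ℝ) + 1) := by
        refine one_div_le_one_div_of_le (by positivity) ?_
        have : (N : ℝ) ≤ k := by exact_mod_cast hkN
        linarith
      rw [← div_le_iff₀' hr]
      linarith
    · rw [Set.indicator_of_notMem hz]
      refine tendsto_const_nhds.congr fun k => ?_
      refine ((b k).zero_of_le_dist ?_).symm
      change r * (1 - 1 / ((k : ℝ) + 2) / 2) ≤ dist z x
      rw [Metric.mem_ball, not_lt] at hz
      refine le_trans ?_ hz
      nlinarith [hk k, mul_pos hr (hk k).1]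

/-- Smooth cutoffs, bounded by one and supported in the ball, converge to its indicator, so
dominated convergence recovers the mass of the ball from test functions. Hence the arbitrary choice
in `distribPartialDeriv` does not affect the quotients in `acDeriv`. -/
theorem HasDistribPartialDeriv.apply_ball_eq {n : ℕ} {u : EuclideanSpace ℝ (Fin n) → ℝ}
    {i : Fin n} {ν ν' : SignedMeasure (EuclideanSpace ℝ (Fin n))} {x : EuclideanSpace ℝ (Fin n)}
    {r : ℝ} (hr : 0 < r) (h : HasDistribPartialDeriv (Metric.ball x r) u i ν)
    (h' : HasDistribPartialDeriv (Metric.ball x r) u i ν') :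
    ν (Metric.ball x r) = ν' (Metric.ball x r) := by
  obtain ⟨φ, hφ, hlim⟩ := exists_seq_contDiff_tendsto_indicator_ball x hr
  have key : ∀ τ : SignedMeasure (EuclideanSpace ℝ (Fin n)),
      Tendsto (fun k => signedIntegral τ (φ k)) atTop (𝓝 (τ (Metric.ball x r))) := by
    intro τ
    have hp : ∀ (p : Measure (EuclideanSpace ℝ (Fin n))) [IsFiniteMeasure p],
        Tendsto (fun k => ∫ z, φ k z ∂p) atTop (𝓝 (p.real (Metric.ball x r))) := by
      intro p _
      rw [← integral_indicator_one measurableSet_ball]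
      exact tendsto_integral_of_dominated_convergence (fun _ => 1)
        (fun k => (hφ k).1.continuous.aestronglyMeasurable) (integrable_const 1)
        (fun k => Eventually.of_forall (hφ k).2.2) (Eventually.of_forall hlim)
    rw [signedMeasure_apply_eq_real_sub τ measurableSet_ball]
    exact (hp _).sub (hp _)
  refine tendsto_nhds_unique (key ν) ((key ν').congr fun k => ?_)
  have hcs := hasCompactSupport_of_tsupport_subset_ball (hφ k).2.1
  have h1 := h (φ k) (hφ k).1 hcs (hφ k).2.1
  have h2 := h' (φ k) (hφ k).1 hcs (hφ k).2.1
  linarith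

theorem acDeriv_apply_eq {n : ℕ} {f : EuclideanSpace ℝ (Fin n) → EuclideanSpace ℝ (Fin n)}
    {U : Set (EuclideanSpace ℝ (Fin n))} (hU : IsOpen U) {i j : Fin n}
    {ν : SignedMeasure (EuclideanSpace ℝ (Fin n))}
    (hν : HasDistribPartialDeriv U (fun z => f z j) i ν) {x : EuclideanSpace ℝ (Fin n)}
    (hx : x ∈ U) {a b : ℝ} (ha : HasDensityAt ν.toJordanDecomposition.posPart x a)
    (hb : HasDensityAt ν.toJordanDecomposition.negPart x b) : acDeriv f x j i = a - b := by
  rw [acDeriv, Matrix.of_apply]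
  refine Tendsto.limUnder_eq ((ha.tendsto.sub hb.tendsto).congr' ?_)
  obtain ⟨R, hR, hRU⟩ := Metric.isOpen_iff.1 hU x hx
  filter_upwards [Ioc_mem_nhdsGT hR] with r hr
  have hνr : HasDistribPartialDeriv (Metric.ball x r) (fun z => f z j) i ν :=
    hν.mono ((Metric.ball_subset_ball hr.2).trans hRU)
  have hex : ∃ ν, HasDistribPartialDeriv (Metric.ball x r) (fun z => f z j) i ν := ⟨ν, hνr⟩
  have hch : HasDistribPartialDeriv (Metric.ball x r) (fun z => f z j) i
      (distribPartialDeriv (Metric.ball x r) (fun z => f z j) i) := by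
    rw [distribPartialDeriv, dif_pos hex]
    exact hex.choose_spec
  rw [hch.apply_ball_eq hr.1 hνr, signedMeasure_apply_eq_real_sub ν measurableSet_ball, sub_div]

/-! ### Differentiability along pieces and the area formula -/

/-- Subtracting a linear map subtracts a multiple of Lebesgue measure from the derivative. The
cutoff makes the function globally integrable, and test functions supported in the ball do not see
it. -/
theorem integral_indicator_sub_mul_fderiv {n : ℕ} {c : EuclideanSpace ℝ (Fin n)} {r : ℝ}
    {u : EuclideanSpace ℝ (Fin n) → ℝ} {i : Fin n}
    {ν : SignedMeasure (EuclideanSpace ℝ (Fin n))} (hu : IntegrableOn u (Metric.ball c r))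
    (hν : HasDistribPartialDeriv (Metric.ball c r) u i ν) (ℓ : EuclideanSpace ℝ (Fin n) →L[ℝ] ℝ)
    (x : EuclideanSpace ℝ (Fin n)) {φ : EuclideanSpace ℝ (Fin n) → ℝ} (hφ : ContDiff ℝ ∞ φ)
    (hs : tsupport φ ⊆ Metric.ball c r) :
    ∫ z, (Metric.ball c r).indicator (fun z => u z - ℓ (z - x)) z *
        fderiv ℝ φ z (EuclideanSpace.single i 1) =
      -signedIntegral ν φ + ℓ (EuclideanSpace.single i 1) * ∫ z, φ z := by
  have hcs := hasCompactSupport_of_tsupport_subset_ball hs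
  have hcont' : Continuous fun z => fderiv ℝ φ z (EuclideanSpace.single i 1) :=
    (hφ.continuous_fderiv (by simp)).clm_apply continuous_const
  have hcs' : HasCompactSupport fun z => fderiv ℝ φ z (EuclideanSpace.single i 1) :=
    (hcs.fderiv (𝕜 := ℝ)).mono fun z hz h0 => hz (by simp [h0])
  have hzero : ∀ z ∉ Metric.ball c r, fderiv ℝ φ z (EuclideanSpace.single i 1) = 0 :=
    fun z hz => by
      rw [fderiv_of_notMem_tsupport ℝ fun hz' => hz (hs hz')]
      simp
  have hfd : ∀ z, fderiv ℝ (fun z => ℓ (z - x)) z = ℓ := fun z =>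
    (ℓ.hasFDerivAt.comp z ((hasFDerivAt_id z).sub_const x)).fderiv.trans (by ext; simp)
  have hparts : ∫ z, ℓ (z - x) * fderiv ℝ φ z (EuclideanSpace.single i 1) =
      -(ℓ (EuclideanSpace.single i 1) * ∫ z, φ z) := by
    rw [integral_mul_fderiv_eq_neg_fderiv_mul_of_integrable, ← integral_const_mul]
    · simp_rw [hfd]
    · simp_rw [hfd]
      exact (hφ.continuous.integrable_of_hasCompactSupport hcs).const_mul _
    · exact Continuous.integrable_of_hasCompactSupport (by fun_prop) hcs'.mul_left
    · exact Continuous.integrable_of_hasCompactSupport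
        ((by fun_prop : Continuous fun z => ℓ (z - x)).mul hφ.continuous) hcs.mul_left
    · intro z _
      fun_prop
    · exact fun z _ => hφ.differentiable (by simp) z
  have hind : IntegrableOn (fun z => u z * fderiv ℝ φ z (EuclideanSpace.single i 1))
      (Metric.ball c r) := by
    obtain ⟨C, hC⟩ := hcont'.bounded_above_of_compact_support hcs'
    exact hu.mul_bdd hcont'.aestronglyMeasurable (Eventually.of_forall hC)
  have hlin : Integrable fun z => ℓ (z - x) * fderiv ℝ φ z (EuclideanSpace.single i 1) :=
    Continuous.integrable_of_hasCompactSupport (by fun_prop) hcs'.mul_left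
  rw [← setIntegral_eq_integral_of_forall_compl_eq_zero (s := Metric.ball c r)
    (fun z hz => by rw [hzero z hz, mul_zero])]
  rw [setIntegral_congr_fun measurableSet_ball (g := fun z =>
    u z * fderiv ℝ φ z (EuclideanSpace.single i 1) -
      ℓ (z - x) * fderiv ℝ φ z (EuclideanSpace.single i 1))
    (fun z hz => by simp only [Set.indicator_of_mem hz, sub_mul]),
    integral_sub hind hlin.integrableOn, hν φ hφ hcs hs,
    setIntegral_eq_integral_of_forall_compl_eq_zero (fun z hz => by rw [hzero z hz, mul_zero]),
    hparts, sub_neg_eq_add]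

/-- A continuous function of bounded variation is differentiable, along the set where the mass of
its derivative is controlled, at every point where the derivative has a density. -/
theorem hasFDerivWithinAt_of_hasDensityAt {n : ℕ} {c : EuclideanSpace ℝ (Fin n)} {r : ℝ}
    {u : EuclideanSpace ℝ (Fin n) → ℝ} {ν : Fin n → SignedMeasure (EuclideanSpace ℝ (Fin n))}
    (hcont : ContinuousOn u (Metric.ball c r)) (hu : IntegrableOn u (Metric.ball c r))
    (hν : ∀ i, HasDistribPartialDeriv (Metric.ball c r) u i (ν i))
    {σ : Measure (EuclideanSpace ℝ (Fin n))} [IsFiniteMeasure σ]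
    (hσ : ∀ i, (ν i).toJordanDecomposition.posPart + (ν i).toJordanDecomposition.negPart ≤ σ)
    (m : ℕ) {x : EuclideanSpace ℝ (Fin n)} (hx : x ∈ Metric.ball c r)
    {a b : Fin n → ℝ} (ha : ∀ i, HasDensityAt (ν i).toJordanDecomposition.posPart x (a i))
    (hb : ∀ i, HasDensityAt (ν i).toJordanDecomposition.negPart x (b i))
    {ℓ : EuclideanSpace ℝ (Fin n) →L[ℝ] ℝ}
    (hℓ : ∀ i, ℓ (EuclideanSpace.single i 1) = a i - b i) :
    HasFDerivWithinAt u ℓ (densityBoundedSet σ m) x := by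
  set κ := volume.real (Metric.ball (0 : EuclideanSpace ℝ (Fin n)) 1) with hκ
  have hκ0 : 0 < κ := ENNReal.toReal_pos (Metric.measure_ball_pos _ _ one_pos).ne'
    measure_ball_lt_top.ne
  set v := (Metric.ball c r).indicator (fun z => u z - ℓ (z - x)) with hv
  have hopen : IsOpen (Metric.ball c r) := Metric.isOpen_ball
  have hvi : Integrable v := by
    rw [hv, integrable_indicator_iff measurableSet_ball]
    refine hu.sub (IntegrableOn.mono_set ?_ Metric.ball_subset_closedBall)
    exact Continuous.continuousOn (by fun_prop) |>.integrableOn_compact (isCompact_closedBall c r)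
  have hvc : ∀ y ∈ Metric.ball c r, ContinuousAt v y := by
    intro y hy
    have h1 : ContinuousAt (fun z => u z - ℓ (z - x)) y :=
      (hcont.continuousAt (hopen.mem_nhds hy)).sub (by fun_prop)
    refine h1.congr ?_
    filter_upwards [hopen.mem_nhds hy] with z hz
    rw [hv, Set.indicator_of_mem hz]
  obtain ⟨R₀, hR₀, hR₀B⟩ := Metric.isOpen_iff.1 hopen x hx
  -- At `x` the densities of the two Jordan parts cancel against the slope of `ℓ`, leaving an error
  -- `ε / 2` from each part.
  have hxb : ∀ ε, 0 < ε → ∃ R, 0 < R ∧ GradientBound v x R ε := by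
    intro ε hε
    choose Ra hRa ha' using fun i => ha i (ε / 2) (half_pos hε)
    choose Rb hRb hb' using fun i => hb i (ε / 2) (half_pos hε)
    obtain ⟨R, hR, hRle⟩ : ∃ R, 0 < R ∧ ∀ i, R ≤ Ra i ∧ R ≤ Rb i := by
      rcases isEmpty_or_nonempty (Fin n) with h | h
      · exact ⟨1, one_pos, fun i => isEmptyElim i⟩
      · refine ⟨Finset.univ.inf' Finset.univ_nonempty (fun i => min (Ra i) (Rb i)), ?_, fun i => ?_⟩
        · rw [Finset.lt_inf'_iff]
          exact fun i _ => lt_min (hRa i) (hRb i)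
        · exact le_min_iff.1 (Finset.inf'_le _ (Finset.mem_univ i))
    refine ⟨min R R₀, lt_min hR hR₀, fun ρ hρ hρR i φ k hφ hs hk => ?_⟩
    have hρ1 : ρ ≤ R := hρR.trans (min_le_left _ _)
    have hsB : tsupport φ ⊆ Metric.ball c r :=
      (hs.trans (Metric.ball_subset_ball (hρR.trans (min_le_right _ _)))).trans hR₀B
    rw [integral_indicator_sub_mul_fderiv hu (hν i) ℓ x hφ hsB, hℓ i, signedIntegral]
    have hs' := (subset_tsupport φ).trans hs
    have h1 := ha' i ρ hρ (hρ1.trans (hRle i).1) φ k hφ.continuous.measurable hk hs'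
    have h2 := hb' i ρ hρ (hρ1.trans (hRle i).2) φ k hφ.continuous.measurable hk hs'
    rw [abs_le] at h1 h2 ⊢
    constructor <;> linarith
  -- At `y` nothing cancels: the mass bound `m` and the crude Lebesgue term `‖ℓ‖ κ` are added. The
  -- radius `R₀ / 2` keeps balls around `y` inside the domain.
  have hyb : ∃ R, 0 < R ∧ ∀ y ∈ densityBoundedSet σ m, ‖y - x‖ < R →
      GradientBound v y R (m + ‖ℓ‖ * κ) := by
    refine ⟨min (1 / ((m : ℝ) + 1)) (R₀ / 2), by positivity,
      fun y hy hyx ρ hρ hρR i φ k hφ hs hk => ?_⟩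
    have hk0 : 0 ≤ k := (abs_nonneg _).trans (hk x)
    have hyx' := hyx.trans_le (min_le_right _ _)
    have hρ' := hρR.trans (min_le_right _ _)
    have hsB : tsupport φ ⊆ Metric.ball c r := by
      refine hs.trans ((Metric.ball_subset_ball' ?_).trans hR₀B)
      rw [dist_eq_norm]
      linarith
    have hs' := (subset_tsupport φ).trans hs
    rw [integral_indicator_sub_mul_fderiv hu (hν i) ℓ x hφ hsB, signedIntegral]
    have h1 := abs_integral_le_of_support_subset (p := (ν i).toJordanDecomposition.posPart) hk hs'
    have h2 := abs_integral_le_of_support_subset (p := (ν i).toJordanDecomposition.negPart) hk hs'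
    have h3 := abs_integral_le_of_support_subset (p := volume) hk hs'
    have h4 : (ν i).toJordanDecomposition.posPart.real (Metric.ball y ρ) +
        (ν i).toJordanDecomposition.negPart.real (Metric.ball y ρ) ≤ m * ρ ^ n := by
      rw [← measureReal_add_apply]
      refine ENNReal.toReal_le_of_le_ofReal (by positivity) ((hσ i _).trans (hy ρ hρ ?_))
      rw [← le_div_iff₀ (by positivity)]
      exact hρR.trans (min_le_left _ _)
    have h5 : |ℓ (EuclideanSpace.single i 1)| ≤ ‖ℓ‖ := by
      have := ℓ.le_opNorm (EuclideanSpace.single i 1)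
      simpa using this
    rw [volume_real_ball y hρ] at h3
    have h6 : |ℓ (EuclideanSpace.single i 1) * ∫ z, φ z| ≤ ‖ℓ‖ * (k * (ρ ^ n * κ)) := by
      rw [abs_mul]
      exact mul_le_mul h5 h3 (abs_nonneg _) (norm_nonneg _)
    have h7 := mul_le_mul_of_nonneg_left h4 hk0
    rw [abs_le] at h1 h2 h6 ⊢
    constructor <;> nlinarith
  obtain ⟨R₁, hR₁, hR₁b⟩ := hyb
  rw [hasFDerivWithinAt_iff_isLittleO, Asymptotics.isLittleO_iff]
  intro e he
  set C := n * 4 ^ n / κ with hC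
  set M := m + ‖ℓ‖ * κ with hM
  have hC0 : 0 ≤ C := by positivity
  have hM0 : 0 ≤ M := by positivity
  -- The order matters: `ε` is chosen after `δ`, since its coefficient contains `(δ ^ n)⁻¹`.
  obtain ⟨δ, hδ, hδ1, hδe⟩ : ∃ δ, 0 < δ ∧ δ ≤ 1 ∧ C * (δ * M) ≤ e / 2 := by
    refine ⟨min 1 (e / 2 / (C * M + 1)), by positivity, min_le_left _ _, ?_⟩
    have h1 : min 1 (e / 2 / (C * M + 1)) ≤ e / 2 / (C * M + 1) := min_le_right _ _
    rw [le_div_iff₀ (by positivity)] at h1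
    have h2 : 0 < min 1 (e / 2 / (C * M + 1)) := by positivity
    nlinarith
  obtain ⟨ε, hε, hεe⟩ : ∃ ε, 0 < ε ∧ C * (2 ^ (n + 1) * (δ ^ n)⁻¹ * ε) ≤ e / 2 := by
    refine ⟨e / 2 / (C * (2 ^ (n + 1) * (δ ^ n)⁻¹) + 1), by positivity, ?_⟩
    rw [← mul_assoc, mul_div_assoc', div_le_iff₀ (by positivity)]
    nlinarith
  obtain ⟨R₂, hR₂, hR₂b⟩ := hxb ε hε
  have hmem : Metric.ball x (min (min R₀ R₁) (R₂ / 2)) ∈ 𝓝[densityBoundedSet σ m] x :=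
    mem_nhdsWithin_of_mem_nhds (Metric.ball_mem_nhds x (by positivity))
  filter_upwards [hmem, self_mem_nhdsWithin] with y hy hyσ
  rw [mem_ball_iff_norm, lt_min_iff, lt_min_iff] at hy
  have hyB : y ∈ Metric.ball c r := hR₀B (mem_ball_iff_norm.2 hy.1.1)
  rcases eq_or_ne x y with rfl | hxy
  · simp
  have h1 := GradientBound.abs_sub_le hvi (hvc x hx) (hvc y hyB) hδ hδ1 hxy
    (hR₂b.mono (by linarith)) ((hR₁b y hyσ hy.1.2).mono
      ((mul_le_of_le_one_left (norm_nonneg _) hδ1).trans hy.1.2.le))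
  rw [hv, Set.indicator_of_mem hx, Set.indicator_of_mem hyB, sub_self, map_zero, sub_zero,
    ← hκ, ← hC] at h1
  rw [Real.norm_eq_abs, sub_right_comm]
  refine h1.trans (mul_le_mul_of_nonneg_right ?_ (norm_nonneg _))
  linarith

theorem toEuclideanCLM_single_apply {n : ℕ} (A : Matrix (Fin n) (Fin n) ℝ) (i j : Fin n) :
    Matrix.toEuclideanCLM (𝕜 := ℝ) A (EuclideanSpace.single i 1) j = A j i := by
  simp [Matrix.ofLp_toEuclideanCLM]

theorem det_toEuclideanCLM {n : ℕ} (A : Matrix (Fin n) (Fin n) ℝ) :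
    (Matrix.toEuclideanCLM (𝕜 := ℝ) A).det = A.det := by
  rw [ContinuousLinearMap.det, Matrix.coe_toEuclideanCLM_eq_toEuclideanLin]
  exact (congrArg (fun T => LinearMap.det (T A)) (Matrix.toLpLin_eq_toLin 2 2)).trans
    (LinearMap.det_toLin _ A)

/-- On a ball, a continuous map of bounded variation is differentiable along each of countably many
measurable sets which cover the ball up to a null set. -/
theorem exists_seq_hasFDerivWithinAt_ball {n : ℕ}
    {f : EuclideanSpace ℝ (Fin n) → EuclideanSpace ℝ (Fin n)} {c : EuclideanSpace ℝ (Fin n)}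
    {r : ℝ} (hf : ContinuousOn f (Metric.ball c r))
    (hBV : ∀ j, IsBV (Metric.ball c r) fun z => f z j) :
    ∃ S : ℕ → Set (EuclideanSpace ℝ (Fin n)), (∀ k, MeasurableSet (S k)) ∧
      (∀ k, S k ⊆ Metric.ball c r) ∧ volume (Metric.ball c r \ ⋃ k, S k) = 0 ∧
      ∀ k, ∀ x ∈ S k,
        HasFDerivWithinAt f (Matrix.toEuclideanCLM (𝕜 := ℝ) (acDeriv f x)) (S k) x := by
  choose ν hν using fun j => (hBV j).2
  let p : Fin n → Fin n → Measure (EuclideanSpace ℝ (Fin n)) :=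
    fun j i => (ν j i).toJordanDecomposition.posPart
  let q : Fin n → Fin n → Measure (EuclideanSpace ℝ (Fin n)) :=
    fun j i => (ν j i).toJordanDecomposition.negPart
  let σ : Measure (EuclideanSpace ℝ (Fin n)) := Measure.sum fun ji : Fin n × Fin n =>
    p ji.1 ji.2 + q ji.1 ji.2
  have hσfin : IsFiniteMeasure σ := by
    refine ⟨?_⟩
    rw [Measure.sum_apply _ MeasurableSet.univ, tsum_fintype]
    exact ENNReal.sum_lt_top.2 fun ji _ => measure_lt_top _ _
  have hσ : ∀ j i, p j i + q j i ≤ σ := fun j i =>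
    Measure.le_sum (fun ji : Fin n × Fin n => p ji.1 ji.2 + q ji.1 ji.2) (j, i)
  have hae : ∀ᵐ x, HasDensityAt σ x (σ.rnDeriv volume x).toReal ∧
      ∀ j i, HasDensityAt (p j i) x ((p j i).rnDeriv volume x).toReal ∧
        HasDensityAt (q j i) x ((q j i).rnDeriv volume x).toReal := by
    refine (ae_hasDensityAt σ).and (ae_all_iff.2 fun j => ae_all_iff.2 fun i => ?_)
    exact (ae_hasDensityAt _).and (ae_hasDensityAt _)
  obtain ⟨N, hN, hNm, hN0⟩ := exists_measurable_superset_of_null (ae_iff.1 hae)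
  have hgood : ∀ x ∉ N, HasDensityAt σ x (σ.rnDeriv volume x).toReal ∧
      ∀ j i, HasDensityAt (p j i) x ((p j i).rnDeriv volume x).toReal ∧
        HasDensityAt (q j i) x ((q j i).rnDeriv volume x).toReal :=
    fun x hx => by_contra fun h => hx (hN h)
  -- Removing a measurable null set `N` makes the densities available at every point of each piece.
  -- Off `N`, the finite density of `σ` places each point of the ball in some `densityBoundedSet σ
  -- m`.
  refine ⟨fun m => (Metric.ball c r ∩ densityBoundedSet σ m) \ N, fun m =>
    (measurableSet_ball.inter (isClosed_densityBoundedSet σ m).measurableSet).diff hNm,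
    fun m x hx => hx.1.1, measure_mono_null ?_ hN0, fun m x hx => ?_⟩
  · rintro x ⟨hxB, hxU⟩
    by_contra hxN
    obtain ⟨m, hm⟩ := (hgood x hxN).1.exists_mem_densityBoundedSet
    exact hxU (Set.mem_iUnion.2 ⟨m, ⟨hxB, hm⟩, hxN⟩)
  · have hd := (hgood x hx.2).2
    rw [hasFDerivWithinAt_euclidean]
    intro j
    refine HasFDerivWithinAt.mono ?_ fun z hz => hz.1.2
    refine hasFDerivWithinAt_of_hasDensityAt (ν := ν j) (c := c) (r := r)
      ((EuclideanSpace.proj (𝕜 := ℝ) j).continuous.comp_continuousOn hf) (hBV j).1 (hν j) (hσ j) m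
      hx.1.1 (fun i => (hd j i).1) (fun i => (hd j i).2) fun i => ?_
    rw [ContinuousLinearMap.comp_apply, PiLp.proj_apply, toEuclideanCLM_single_apply]
    exact acDeriv_apply_eq Metric.isOpen_ball (hν j i) hx.1.1 (hd j i).1 (hd j i).2

/-- Countably many of the balls from `IsBVLoc` cover `Ω`, by the Lindelöf property; the doubly
indexed pieces are enumerated by `Nat.unpair`. -/
theorem exists_seq_hasFDerivWithinAt {n : ℕ}
    {f : EuclideanSpace ℝ (Fin n) → EuclideanSpace ℝ (Fin n)} {Ω : Set (EuclideanSpace ℝ (Fin n))}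
    (hf : ContinuousOn f Ω) (hBV : IsBVLoc Ω f) :
    ∃ S : ℕ → Set (EuclideanSpace ℝ (Fin n)), (∀ k, MeasurableSet (S k)) ∧
      (∀ k, S k ⊆ Ω) ∧ volume (Ω \ ⋃ k, S k) = 0 ∧
      ∀ k, ∀ x ∈ S k,
        HasFDerivWithinAt f (Matrix.toEuclideanCLM (𝕜 := ℝ) (acDeriv f x)) (S k) x := by
  rcases Ω.eq_empty_or_nonempty with rfl | ⟨x₀, hx₀⟩
  · exact ⟨fun _ => ∅, by simp⟩
  choose! c r hcr using hBV
  obtain ⟨t, htΩ, htc, ht⟩ := TopologicalSpace.countable_cover_nhdsWithin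
    (f := fun x => Metric.ball (c x) (r x)) (s := Ω)
    fun x hx => mem_nhdsWithin_of_mem_nhds (Metric.isOpen_ball.mem_nhds (hcr x hx).1)
  have htne : t.Nonempty := by
    obtain ⟨y, hy, -⟩ := Set.mem_iUnion₂.1 (ht hx₀)
    exact ⟨y, hy⟩
  obtain ⟨e, rfl⟩ := htc.exists_eq_range htne
  have he : ∀ a, e a ∈ Ω := fun a => htΩ ⟨a, rfl⟩
  choose S hSm hSB hS0 hSd using fun a => exists_seq_hasFDerivWithinAt_ball
    (hf.mono (hcr (e a) (he a)).2.1) (hcr (e a) (he a)).2.2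
  refine ⟨fun k => S k.unpair.1 k.unpair.2, fun k => hSm _ _,
    fun k => (hSB _ _).trans (hcr _ (he _)).2.1, ?_, fun k => hSd _ _⟩
  refine measure_mono_null ?_ (measure_iUnion_null hS0)
  rintro x ⟨hxΩ, hxS⟩
  obtain ⟨y, ⟨a, rfl⟩, hy⟩ := Set.mem_iUnion₂.1 (ht hxΩ)
  refine Set.mem_iUnion.2 ⟨a, hy, fun hx => hxS ?_⟩
  obtain ⟨b, hb⟩ := Set.mem_iUnion.1 hx
  exact Set.mem_iUnion.2 ⟨Nat.pair a b, by simpa using hb⟩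

/-- The area formula for injective continuous maps of locally bounded variation, off a null set. -/
theorem exists_lintegral_image_eq_lintegral_acJacobian {n : ℕ}
    {f : EuclideanSpace ℝ (Fin n) → EuclideanSpace ℝ (Fin n)} {Ω : Set (EuclideanSpace ℝ (Fin n))}
    (hf : ContinuousOn f Ω) (hinj : Set.InjOn f Ω) (hBV : IsBVLoc Ω f) :
    (∀ j i, AEMeasurable (fun x => acDeriv f x j i) (volume.restrict Ω)) ∧
    ∃ G : Set (EuclideanSpace ℝ (Fin n)), MeasurableSet G ∧ G ⊆ Ω ∧ volume (Ω \ G) = 0 ∧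
      ∀ A ⊆ G, MeasurableSet A → MeasurableSet (f '' A) ∧
        ∀ g : EuclideanSpace ℝ (Fin n) → ℝ≥0∞,
          ∫⁻ y in f '' A, g y = ∫⁻ x in A, ENNReal.ofReal |acJacobian f x| * g (f x) := by
  obtain ⟨S, hSm, hSΩ, hS0, hSd⟩ := exists_seq_hasFDerivWithinAt hf hBV
  have hGm : MeasurableSet (⋃ k, S k) := MeasurableSet.iUnion hSm
  have hGΩ : ⋃ k, S k ⊆ Ω := Set.iUnion_subset hSΩ
  refine ⟨?_, ⋃ k, S k, hGm, hGΩ, hS0, fun A hAG hA => ?_⟩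
  · intro j i
    have hres : volume.restrict Ω = volume.restrict (⋃ k, S k) :=
      Measure.restrict_congr_set ((ae_le_set.2 hS0).antisymm hGΩ.eventuallyLE)
    rw [hres, aemeasurable_iUnion_iff]
    intro k
    have h1 := aemeasurable_fderivWithin volume (hSm k) (hSd k)
    have h2 : (fun x => acDeriv f x j i) = fun x =>
        Matrix.toEuclideanCLM (𝕜 := ℝ) (acDeriv f x) (EuclideanSpace.single i 1) j :=
      funext fun x => (toEuclideanCLM_single_apply _ i j).symm
    rw [h2]
    have h3 : Continuous fun T : EuclideanSpace ℝ (Fin n) →L[ℝ] EuclideanSpace ℝ (Fin n) =>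
        T (EuclideanSpace.single i 1) j := by fun_prop
    exact h3.measurable.comp_aemeasurable h1
  · let T : ℕ → Set (EuclideanSpace ℝ (Fin n)) := fun k => A ∩ disjointed S k
    have hTm : ∀ k, MeasurableSet (T k) := fun k => hA.inter (MeasurableSet.disjointed hSm k)
    have hTd : Pairwise (Function.onFun Disjoint T) := fun a b hab =>
      (disjoint_disjointed S hab).mono Set.inter_subset_right Set.inter_subset_right
    have hTS : ∀ k, T k ⊆ S k := fun k => Set.inter_subset_right.trans (disjointed_subset S k)
    have hAT : A = ⋃ k, T k := by
      rw [← Set.inter_iUnion, iUnion_disjointed, Set.inter_eq_left.2 hAG]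
    have hTf : ∀ k, ∀ x ∈ T k,
        HasFDerivWithinAt f (Matrix.toEuclideanCLM (𝕜 := ℝ) (acDeriv f x)) (T k) x :=
      fun k x hx => (hSd k x (hTS k hx)).mono (hTS k)
    have hTi : ∀ k, Set.InjOn f (T k) := fun k => hinj.mono ((hTS k).trans (hSΩ k))
    have hfm : ∀ k, MeasurableSet (f '' T k) := fun k =>
      measurable_image_of_fderivWithin (hTm k) (hTf k) (hTi k)
    have hfA : f '' A = ⋃ k, f '' T k := by rw [← Set.image_iUnion, ← hAT]
    have hfd : Pairwise (Function.onFun Disjoint fun k => f '' T k) := fun a b hab =>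
      (hTd hab).image hinj ((hTS a).trans (hSΩ a)) ((hTS b).trans (hSΩ b))
    refine ⟨hfA ▸ MeasurableSet.iUnion hfm, fun g => ?_⟩
    rw [hfA, lintegral_iUnion hfm hfd]
    conv_rhs => rw [hAT, lintegral_iUnion hTm hTd]
    refine tsum_congr fun k => ?_
    rw [lintegral_image_eq_lintegral_abs_det_fderiv_mul volume (hTm k) (hTf k) (hTi k)]
    simp_rw [det_toEuclideanCLM]
    rfl

/-! ### Change of variables in `L^{q'}` and the equivalence -/

open Classical in
/-- The `L^{q'}` norm with respect to a weighted measure `J μ`. -/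
theorem eLpNorm_withDensity_conjExponent {α : Type*} [MeasurableSpace α] {μ : Measure α}
    {J w : α → ℝ} (hJ : Measurable J) (hJ0 : ∀ x, 0 ≤ J x) (hw : Measurable w) {q : ℝ}
    (hq : 1 ≤ q) :
    eLpNorm w (ENNReal.conjExponent (ENNReal.ofReal q))
        (μ.withDensity fun x => ENNReal.ofReal (J x)) =
      eLpNorm (fun x => if J x = 0 then 0 else w x * J x ^ (1 - 1 / q))
        (ENNReal.conjExponent (ENNReal.ofReal q)) μ := by
  have hJm : Measurable fun x => ENNReal.ofReal (J x) := hJ.ennreal_ofReal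
  rcases hq.eq_or_lt with rfl | hq1
  · have hp : ENNReal.conjExponent (ENNReal.ofReal 1) = ⊤ := by
      simp [ENNReal.conjExponent]
    rw [hp, eLpNorm_exponent_top, eLpNorm_exponent_top, eLpNormEssSup, eLpNormEssSup,
      essSup_eq_sInf, essSup_eq_sInf]
    congr 1
    ext a
    simp only [Set.mem_ofPred_eq]
    rw [withDensity_apply_eq_zero hJm]
    -- For `q = 1` the power `J x ^ 0` is one even where `J` vanishes, hence the explicit value zero
    -- there: such points are null for the weighted measure.
    have : ({x | ENNReal.ofReal (J x) ≠ 0} ∩ {x | a < ‖w x‖ₑ}) =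
        {x | a < ‖if J x = 0 then 0 else w x * J x ^ (1 - 1 / (1 : ℝ))‖ₑ} := by
      ext x
      by_cases hx : J x = 0
      · simp [hx]
      · have hpos : 0 < J x := lt_of_le_of_ne (hJ0 x) (Ne.symm hx)
        simp [hx, hpos]
    rw [this]
  · have hq0 : 0 < q - 1 := by linarith
    have hp : ENNReal.conjExponent (ENNReal.ofReal q) = ENNReal.ofReal (q / (q - 1)) := by
      rw [ENNReal.conjExponent, ← ENNReal.ofReal_one, ← ENNReal.ofReal_sub _ zero_le_one,
        ← ENNReal.ofReal_inv_of_pos hq0, ← ENNReal.ofReal_add zero_le_one (by positivity)]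
      congr 1
      field_simp
      ring
    have hp0 : 0 < q / (q - 1) := by positivity
    rw [hp, eLpNorm_eq_lintegral_rpow_enorm_toReal (ENNReal.ofReal_pos.2 hp0).ne'
      ENNReal.ofReal_ne_top, eLpNorm_eq_lintegral_rpow_enorm_toReal (ENNReal.ofReal_pos.2 hp0).ne'
      ENNReal.ofReal_ne_top, ENNReal.toReal_ofReal hp0.le,
      lintegral_withDensity_eq_lintegral_mul _ hJm (by fun_prop)]
    congr 1
    refine lintegral_congr fun x => ?_
    by_cases hx : J x = 0
    · simp [hx, hp0]
    · rw [if_neg hx, enorm_mul, ENNReal.mul_rpow_of_nonneg _ _ hp0.le, Pi.mul_apply, mul_comm]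
      congr 1
      rw [Real.enorm_of_nonneg (Real.rpow_nonneg (hJ0 x) _),
        ENNReal.ofReal_rpow_of_nonneg (Real.rpow_nonneg (hJ0 x) _) hp0.le,
        ← Real.rpow_mul (hJ0 x)]
      have : (1 - 1 / q) * (q / (q - 1)) = 1 := by
        field_simp
      rw [this, Real.rpow_one]

-- This carries norms on `f '' G` to weighted norms on `G`. The extension of `f` by zero off `G`
-- only serves global measurability.
open Classical in
theorem map_withDensity_eq_restrict_image {n : ℕ}
    {f : EuclideanSpace ℝ (Fin n) → EuclideanSpace ℝ (Fin n)} {G : Set (EuclideanSpace ℝ (Fin n))}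
    {J : EuclideanSpace ℝ (Fin n) → ℝ} (hf : ContinuousOn f G) (hG : MeasurableSet G)
    (harea : ∀ A ⊆ G, MeasurableSet A → MeasurableSet (f '' A) ∧
        ∀ g : EuclideanSpace ℝ (Fin n) → ℝ≥0∞,
          ∫⁻ y in f '' A, g y = ∫⁻ x in A, ENNReal.ofReal (J x) * g (f x)) :
    Measure.map (G.piecewise f 0) ((volume.restrict G).withDensity fun x => ENNReal.ofReal (J x)) =
      volume.restrict (f '' G) := by
  have hF : Measurable (G.piecewise f 0) := hf.measurable_piecewise continuousOn_const hG
  ext A hA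
  have hAm : MeasurableSet (G.piecewise f 0 ⁻¹' A ∩ G) := (hF hA).inter hG
  have himg : f '' (G.piecewise f 0 ⁻¹' A ∩ G) = A ∩ f '' G := by
    ext y
    constructor
    · rintro ⟨x, ⟨hxA, hxG⟩, rfl⟩
      rw [Set.mem_preimage, Set.piecewise_eq_of_mem _ _ _ hxG] at hxA
      exact ⟨hxA, x, hxG, rfl⟩
    · rintro ⟨hyA, x, hxG, rfl⟩
      refine ⟨x, ⟨?_, hxG⟩, rfl⟩
      rwa [Set.mem_preimage, Set.piecewise_eq_of_mem _ _ _ hxG]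
  have h := (harea _ Set.inter_subset_right hAm).2 1
  rw [Measure.map_apply hF hA, withDensity_apply _ (hF hA), Measure.restrict_restrict (hF hA),
    Measure.restrict_apply hA, ← himg]
  simpa using h.symm

open Classical in
/-- The equivalence for an abstract pair of densities which satisfies the area formula. -/
theorem exists_lintegral_le_iff_of_area_formula {n : ℕ}
    (f : OpenPartialHomeomorph (EuclideanSpace ℝ (Fin n)) (EuclideanSpace ℝ (Fin n)))
    {D J : EuclideanSpace ℝ (Fin n) → ℝ} (hD : Measurable D) (hD0 : ∀ x, 0 ≤ D x)
    (hJ : Measurable J) (hJ0 : ∀ x, 0 ≤ J x) {G : Set (EuclideanSpace ℝ (Fin n))}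
    (hG : MeasurableSet G) (hGs : G ⊆ f.source) (hG0 : volume (f.source \ G) = 0)
    (harea : ∀ A ⊆ G, MeasurableSet A → MeasurableSet (f '' A) ∧
        ∀ g : EuclideanSpace ℝ (Fin n) → ℝ≥0∞,
          ∫⁻ y in f '' A, g y = ∫⁻ x in A, ENNReal.ofReal (J x) * g (f x))
    {q : ℝ} (hq : 1 ≤ q) :
    (∃ K : EuclideanSpace ℝ (Fin n) → ℝ, (∀ y, 0 ≤ K y) ∧
        MemLp K (ENNReal.conjExponent (ENNReal.ofReal q)) (volume.restrict f.target) ∧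
        ∀ A : Set (EuclideanSpace ℝ (Fin n)), MeasurableSet A → A ⊆ f.target →
          ∫⁻ x in f.source ∩ f ⁻¹' A, ENNReal.ofReal (D x) ≤ ∫⁻ y in A, ENNReal.ofReal (K y)) ↔
      ∃ L : EuclideanSpace ℝ (Fin n) → ℝ,
        MemLp L (ENNReal.conjExponent (ENNReal.ofReal q)) (volume.restrict f.source) ∧
        ∀ᵐ x ∂volume.restrict f.source, D x ≤ L x * J x ^ (1 / q) := by
  have hq0 : 0 < q := zero_lt_one.trans_le hq
  have hfG : ContinuousOn f G := f.continuousOn.mono hGs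
  have hres : volume.restrict f.source = volume.restrict G :=
    Measure.restrict_congr_set ((ae_le_set.2 hG0).antisymm hGs.eventuallyLE)
  set F := G.piecewise f 0 with hFdef
  have hF : Measurable F := hfG.measurable_piecewise continuousOn_const hG
  have hFG : ∀ x ∈ G, F x = f x := fun x hx => Set.piecewise_eq_of_mem _ _ _ hx
  have himgt : f '' G ⊆ f.target := by
    rintro _ ⟨x, hx, rfl⟩
    exact f.map_source (hGs hx)
  have himgm : MeasurableSet (f '' G) := (harea G subset_rfl hG).1
  have hmap := map_withDensity_eq_restrict_image hfG hG harea
  rw [hres]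
  constructor
  · rintro ⟨K₀, hK₀0, hK₀, hK₀A⟩
    -- A measurable representative, truncated below at zero so that it is nonnegative everywhere.
    obtain ⟨K₁, hK₁m, hK₁⟩ := hK₀.1
    set K : EuclideanSpace ℝ (Fin n) → ℝ := fun y => max (K₁ y) 0 with hKdef
    have hKm : Measurable K := hK₁m.measurable.max measurable_const
    have hKK₀ : K₀ =ᵐ[volume.restrict f.target] K := by
      filter_upwards [hK₁] with y hy
      rw [hKdef]
      simp only [← hy, max_eq_left (hK₀0 y)]
    have hK : MemLp K (ENNReal.conjExponent (ENNReal.ofReal q)) (volume.restrict (f '' G)) :=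
      (hK₀.ae_eq hKK₀).mono_measure (Measure.restrict_mono himgt le_rfl)
    rw [← hmap] at hK
    have hKF := (memLp_map_measure_iff hKm.aestronglyMeasurable hF.aemeasurable).1 hK
    refine ⟨fun x => if J x = 0 then 0 else K (F x) * J x ^ (1 - 1 / q), ⟨?_, ?_⟩, ?_⟩
    · exact (Measurable.ite (hJ (measurableSet_singleton 0)) measurable_const
        ((hKm.comp hF).mul (hJ.pow_const _))).aestronglyMeasurable
    · exact (eLpNorm_withDensity_conjExponent hJ hJ0 (hKm.comp hF) hq).symm.trans_lt hKF.2
    · have hle : (fun x => ENNReal.ofReal (D x)) ≤ᵐ[volume.restrict G]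
          fun x => ENNReal.ofReal (J x) * ENNReal.ofReal (K (F x)) := by
        -- The hypothesis is tested on the images `f '' (s ∩ G)`, which are measurable by the area
        -- formula.
        refine ae_le_of_forall_setLIntegral_le_of_sigmaFinite hD.ennreal_ofReal
          fun s hs _ => ?_
        rw [Measure.restrict_restrict hs]
        have hsm : MeasurableSet (s ∩ G) := hs.inter hG
        obtain ⟨him, hint⟩ := harea (s ∩ G) Set.inter_subset_right hsm
        have hsub : f '' (s ∩ G) ⊆ f.target := (Set.image_mono Set.inter_subset_right).trans himgt
        calc ∫⁻ x in s ∩ G, ENNReal.ofReal (D x)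
            ≤ ∫⁻ x in f.source ∩ f ⁻¹' (f '' (s ∩ G)), ENNReal.ofReal (D x) :=
              lintegral_mono_set fun x hx => ⟨hGs hx.2, x, hx, rfl⟩
          _ ≤ ∫⁻ y in f '' (s ∩ G), ENNReal.ofReal (K₀ y) := hK₀A _ him hsub
          _ = ∫⁻ y in f '' (s ∩ G), ENNReal.ofReal (K y) := by
              refine lintegral_congr_ae ?_
              filter_upwards [ae_restrict_of_ae_restrict_of_subset hsub hKK₀] with y hy
              rw [hy]
          _ = ∫⁻ x in s ∩ G, ENNReal.ofReal (J x) * ENNReal.ofReal (K (f x)) := hint _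
          _ = ∫⁻ x in s ∩ G, ENNReal.ofReal (J x) * ENNReal.ofReal (K (F x)) :=
              setLIntegral_congr_fun hsm fun x hx => by simp only [hFG x hx.2]
      filter_upwards [hle] with x hx
      have hKx : 0 ≤ K (F x) := le_max_right _ _
      rw [← ENNReal.ofReal_mul (hJ0 x), ENNReal.ofReal_le_ofReal_iff (mul_nonneg (hJ0 x) hKx)] at hx
      by_cases hJx : J x = 0
      · simpa [hJx] using hx
      · have hpos : 0 < J x := lt_of_le_of_ne (hJ0 x) (Ne.symm hJx)
        rw [if_neg hJx, mul_assoc, ← Real.rpow_add hpos, sub_add_cancel, Real.rpow_one, mul_comm]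
        exact hx
  · rintro ⟨L, hL, hLD⟩
    -- Where `J` vanishes this quotient is zero; the bound by `L` forces `D` to vanish almost
    -- everywhere there as well, since `1 / q > 0`.
    set w : EuclideanSpace ℝ (Fin n) → ℝ := fun x => D x / J x with hw
    have hwm : Measurable w := hD.div hJ
    have hw0 : ∀ x, 0 ≤ w x := fun x => div_nonneg (hD0 x) (hJ0 x)
    set H := (f '' G).piecewise f.symm 0 with hHdef
    have hH : Measurable H :=
      (f.continuousOn_symm.mono himgt).measurable_piecewise continuousOn_const himgm
    have hHf : ∀ x ∈ G, H (f x) = x := fun x hx => by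
      rw [hHdef, Set.piecewise_eq_of_mem _ _ _ (Set.mem_image_of_mem f hx), f.left_inv (hGs hx)]
    set K : EuclideanSpace ℝ (Fin n) → ℝ := (f '' G).indicator (w ∘ H) with hK
    have hKm : Measurable K := (hwm.comp hH).indicator himgm
    have hKf : ∀ x ∈ G, K (f x) = w x := fun x hx => by
      rw [hK, Set.indicator_of_mem (Set.mem_image_of_mem f hx), Function.comp_apply, hHf x hx]
    refine ⟨K, fun y => Set.indicator_nonneg (fun _ _ => hw0 _) y,
      ⟨hKm.aestronglyMeasurable, ?_⟩, fun A hA hAt => ?_⟩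
    · have h1 : eLpNorm K (ENNReal.conjExponent (ENNReal.ofReal q)) (volume.restrict f.target) =
          eLpNorm w (ENNReal.conjExponent (ENNReal.ofReal q))
            ((volume.restrict G).withDensity fun x => ENNReal.ofReal (J x)) := by
        have h2 : eLpNorm K (ENNReal.conjExponent (ENNReal.ofReal q)) (volume.restrict f.target) =
            eLpNorm K (ENNReal.conjExponent (ENNReal.ofReal q)) (volume.restrict (f '' G)) := by
          conv_lhs => rw [hK]
          rw [eLpNorm_indicator_eq_eLpNorm_restrict himgm, Measure.restrict_restrict himgm,
            Set.inter_eq_left.2 himgt]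
          refine eLpNorm_congr_ae ?_
          filter_upwards [ae_restrict_mem himgm] with y hy
          rw [hK, Set.indicator_of_mem hy]
        rw [h2, ← hmap, eLpNorm_map_measure hKm.aestronglyMeasurable hF.aemeasurable]
        refine eLpNorm_congr_ae ((withDensity_absolutelyContinuous _ _).ae_le ?_)
        filter_upwards [ae_restrict_mem hG] with x hx
        rw [Function.comp_apply, hFG x hx, hKf x hx]
      rw [h1, eLpNorm_withDensity_conjExponent hJ hJ0 hwm hq]
      refine (eLpNorm_mono_ae ?_).trans_lt hL.2
      filter_upwards [hLD] with x hx
      by_cases hJx : J x = 0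
      · simp [hJx]
      · have hpos : 0 < J x := lt_of_le_of_ne (hJ0 x) (Ne.symm hJx)
        rw [if_neg hJx, Real.norm_of_nonneg (mul_nonneg (hw0 x) (Real.rpow_nonneg (hJ0 x) _)), hw,
          Real.rpow_sub hpos, Real.rpow_one, div_mul_div_cancel₀ hJx]
        refine le_trans ?_ (le_abs_self _)
        rwa [div_le_iff₀ (Real.rpow_pos_of_pos hpos _)]
    · have hEm : MeasurableSet (F ⁻¹' A ∩ G) := (hF hA).inter hG
      obtain ⟨him, hint⟩ := harea (F ⁻¹' A ∩ G) Set.inter_subset_right hEm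
      calc ∫⁻ x in f.source ∩ f ⁻¹' A, ENNReal.ofReal (D x)
          -- The part of the domain outside `G` is null, so its image is irrelevant here and `K` may
          -- vanish off `f '' G`.
          ≤ ∫⁻ x in (F ⁻¹' A ∩ G) ∪ (f.source \ G), ENNReal.ofReal (D x) := by
            refine lintegral_mono_set fun x hx => ?_
            by_cases hxG : x ∈ G
            · exact Or.inl ⟨by rw [Set.mem_preimage, hFG x hxG]; exact hx.2, hxG⟩
            · exact Or.inr ⟨hx.1, hxG⟩
        _ ≤ ∫⁻ x in F ⁻¹' A ∩ G, ENNReal.ofReal (D x) := by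
            refine (lintegral_union_le _ _ _).trans ?_
            rw [Measure.restrict_eq_zero.2 hG0, lintegral_zero_measure, add_zero]
        _ = ∫⁻ x in F ⁻¹' A ∩ G, ENNReal.ofReal (J x) * ENNReal.ofReal (K (f x)) := by
            refine lintegral_congr_ae ?_
            filter_upwards [ae_restrict_of_ae_restrict_of_subset Set.inter_subset_right hLD,
              ae_restrict_mem hEm] with x hx hxE
            rw [hKf x hxE.2, ← ENNReal.ofReal_mul (hJ0 x)]
            congr 1
            by_cases hJx : J x = 0
            · rw [hJx, Real.zero_rpow (by positivity), mul_zero] at hx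
              rw [hJx, zero_mul]
              exact le_antisymm hx (hD0 x)
            · exact (mul_div_cancel₀ _ hJx).symm
        _ = ∫⁻ y in f '' (F ⁻¹' A ∩ G), ENNReal.ofReal (K y) :=
            (hint fun y => ENNReal.ofReal (K y)).symm
        _ ≤ ∫⁻ y in A, ENNReal.ofReal (K y) := by
            refine lintegral_mono_set ?_
            rintro _ ⟨x, ⟨hxA, hxG⟩, rfl⟩
            rwa [Set.mem_preimage, hFG x hxG] at hxA

theorem mainTheorem3 {n : ℕ} (Ω₁ Ω₂ : Set (EuclideanSpace ℝ (Fin n)))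
    (f : OpenPartialHomeomorph (EuclideanSpace ℝ (Fin n)) (EuclideanSpace ℝ (Fin n)))
    (hsource : f.source = Ω₁) (htarget : f.target = Ω₂) (hf : IsBVLoc Ω₁ f)
    (q : ℝ) (hq : 1 ≤ q) :
    (∃ K : EuclideanSpace ℝ (Fin n) → ℝ, (∀ y, 0 ≤ K y) ∧
        MemLp K (ENNReal.conjExponent (ENNReal.ofReal q)) (volume.restrict Ω₂) ∧
        ∀ A : Set (EuclideanSpace ℝ (Fin n)), MeasurableSet A → A ⊆ Ω₂ →
          ∫⁻ x in Ω₁ ∩ f ⁻¹' A, ENNReal.ofReal (matrixNorm (acDeriv f x)) ≤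
            ∫⁻ y in A, ENNReal.ofReal (K y)) ↔
      ∃ L : EuclideanSpace ℝ (Fin n) → ℝ,
        MemLp L (ENNReal.conjExponent (ENNReal.ofReal q)) (volume.restrict Ω₁) ∧
        ∀ᵐ x ∂volume.restrict Ω₁,
          matrixNorm (acDeriv f x) ≤ L x * |acJacobian f x| ^ (1 / q) := by
  subst hsource htarget
  obtain ⟨hm, G, hG, hGs, hG0, harea⟩ :=
    exists_lintegral_image_eq_lintegral_acJacobian f.continuousOn f.injOn hf
  have hDm : AEMeasurable (fun x => matrixNorm (acDeriv f x)) (volume.restrict f.source) := by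
    unfold matrixNorm
    refine AEMeasurable.sqrt (Finset.aemeasurable_fun_sum _ fun j _ => ?_)
    exact Finset.aemeasurable_fun_sum _ fun i _ => (hm j i).pow_const 2
  have hJm : AEMeasurable (fun x => |acJacobian f x|) (volume.restrict f.source) := by
    unfold acJacobian
    simp_rw [Matrix.det_apply]
    refine continuous_abs.measurable.comp_aemeasurable
      (Finset.aemeasurable_fun_sum _ fun τ _ => ?_)
    exact (Finset.aemeasurable_fun_prod _ fun i _ => hm _ _).const_smul _
  -- Both densities are only almost everywhere measurable. They are replaced by absolute values of
  -- measurable representatives, which are nonnegative everywhere.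
  obtain ⟨D, hD, hDe⟩ := hDm
  obtain ⟨J, hJ, hJe⟩ := hJm
  have hDe' : (fun x => matrixNorm (acDeriv f x)) =ᵐ[volume.restrict f.source] fun x => |D x| := by
    filter_upwards [hDe] with x hx
    rw [← hx, matrixNorm, abs_of_nonneg (Real.sqrt_nonneg _)]
  have hJe' : (fun x => |acJacobian f x|) =ᵐ[volume.restrict f.source] fun x => |J x| := by
    filter_upwards [hJe] with x hx
    rw [← hx, abs_abs]
  have harea' : ∀ A ⊆ G, MeasurableSet A → MeasurableSet (f '' A) ∧
        ∀ g : EuclideanSpace ℝ (Fin n) → ℝ≥0∞,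
          ∫⁻ y in f '' A, g y = ∫⁻ x in A, ENNReal.ofReal |J x| * g (f x) := by
    refine fun A hAG hA => ⟨(harea A hAG hA).1, fun g => ?_⟩
    rw [(harea A hAG hA).2 g]
    refine lintegral_congr_ae ?_
    filter_upwards [ae_restrict_of_ae_restrict_of_subset (hAG.trans hGs) hJe'] with x hx
    rw [hx]
  have key := exists_lintegral_le_iff_of_area_formula f hD.abs (fun x => abs_nonneg _) hJ.abs
    (fun x => abs_nonneg _) hG hGs hG0 harea' hq
  have hleft : ∀ A, ∫⁻ x in f.source ∩ f ⁻¹' A, ENNReal.ofReal (matrixNorm (acDeriv f x)) =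
      ∫⁻ x in f.source ∩ f ⁻¹' A, ENNReal.ofReal |D x| := fun A => by
    refine lintegral_congr_ae ?_
    filter_upwards [ae_restrict_of_ae_restrict_of_subset Set.inter_subset_left hDe'] with x hx
    rw [hx]
  simp_rw [hleft]
  rw [key]
  refine exists_congr fun L => and_congr_right fun _ => ?_
  refine eventually_congr ?_
  filter_upwards [hDe', hJe'] with x h1 h2
  rw [h1, h2]
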